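/- Let $K$ be a field and $D$ a set. **Definitions.** A dendriform algebra is a $K$-vector space $A$ with bilinear products $\prec,\succ$ such that, with $ab=a\prec b+a\succ b$, $$(a\prec b)\prec c=a\prec(bc),\qquad (a\succ b)\prec c=a\succ(b\prec c),\qquad (ab)\succ c=a\succ(b\succ c).$$ A dendriform coalgebra is a $K$-vector space $A$ with linear maps $\Delta_\prec,\Delta_\succ:A\to A\otimes A$ such that, with $\tilde\Delta=\Delta_\prec+\Delta_\succ$, $$(\Delta_\prec\otimes \mathrm{Id})\Delta_\prec=(\mathrm{Id}\otimes\tilde\Delta)\Delta_\prec,\quad (\Delta_\succ\otimes \mathrm{Id})\Delta_\prec=(\mathrm{Id}\otimes\Delta_\prec)\Delta_\succ,\quad (\tilde\Delta\otimes \mathrm{Id})\Delta_\succ=(\mathrm{Id}\otimes\Delta_\succ)\Delta_\succ .$$ A bidendriform bialgebra is a family $(A,\prec,\succ,\Delta_\prec,\Delta_\succ)$ that is both, such that for all $a,b\in A$, writing $\tilde\Delta(a)=a'\otimes a''$, $\Delta_\prec(b)=b'_\prec\otimes b''_\prec$ and $\Delta_\succ(b)=b'_\succ\otimes b''_\succ$,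 $$\begin{aligned} \Delta_\succ(a\succ b)&=a'b'_\succ\otimes a''\succ b''_\succ+a'\otimes a''\succ b+b'_\succ\otimes a\succ b''_\succ+ab'_\succ\otimes b''_\succ+a\otimes b,\\ \Delta_\succ(a\prec b)&=a'b'_\succ\otimes a''\prec b''_\succ+a'\otimes a''\prec b+b'_\succ\otimes a\prec b''_\succ,\\ \Delta_\prec(a\succ b)&=a'b'_\prec\otimes a''\succ b''_\prec+ab'_\prec\otimes b''_\prec+b'_\prec\otimes a\succ b''_\prec,\\ \Delta_\prec(a\prec b)&=a'b'_\prec\otimes a''\prec b''_\prec+a'b\otimes a''+b'_\prec\otimes a\prec b''_\prec+b\otimes a. \end{aligned}$$ Let $\mathcal H^D$ be the free associative unital $K$-algebra on the set of planar rooted trees with vertices decorated by $D$; its monomials, the planar forests, form a basis. It carries the Connes–Kreimer coproduct $\Delta(F)=\sum_c P^c(F)\otimes R^c(F)$, the sum being over all admissible cuts $c$ of the forest $F$, including the empty and the total one (a cut of a forest is a tuple of cuts of its trees; a cut of a tree is either the total cut or a possibly empty set of edges such that every path from the root meets at most one of them; $R^c$ is formed by the components of the roots and $P^c$ by the other components,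 in the planar order; for the total cut of a tree $t$, $P^c=t$ and $R^c=1$), and the counit $\varepsilon$ with $\varepsilon(1)=1$ and $\varepsilon(F)=0$ for $F\neq 1$. Let $\mathcal A^D=\ker\varepsilon$ be the augmentation ideal, with the reduced coproduct $\tilde\Delta$ given by $\Delta(a)=a\otimes 1+1\otimes a+\tilde\Delta(a)$. For $d\in D$ let $\bullet_d$ be the single vertex decorated by $d$, and let $B_d^+$ be the linear map that grafts the trees of a forest on a common root decorated by $d$. The known dendriform structure of $\mathcal A^D$ is the one for which $a\prec b+a\succ b$ is the product $ab$ of $\mathcal H^D$ and $\bullet_d\prec x=B_d^+(x)$ for all $d\in D$ and $x\in\mathcal A^D$; explicitly, with the convention $1\prec x=0$, for a tree $t=B_d^+(G)$, a forest $F$ and $x\in\mathcal A^D$, $$(tF)\prec x=t\,(F\prec x)+B_d^+\bigl(G\,(Fx-F\prec x)\bigr).$$ **Theorem.** 1. There is a unique pair of linear maps $\Delta_\prec,\Delta_\succ:\mathcal A^D\to\mathcal A^D\otimes\mathcal A^D$ such that $(\mathcal A^D,\prec,\succ,\Delta_\prec,\Delta_\succ)$ is a bidendriform bialgebra, where $\prec,\succ$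 is the known dendriform structure, $\Delta_\prec+\Delta_\succ=\tilde\Delta$, and $\Delta_\prec(\bullet_d)=\Delta_\succ(\bullet_d)=0$ for all $d\in D$. 2. $(\mathcal H^D,\Delta,\varepsilon)$ is a Hopf algebra, and it is induced by this bidendriform structure: for any $\Delta_\prec,\Delta_\succ$ that make $(\mathcal A^D,\prec,\succ,\Delta_\prec,\Delta_\succ)$ a bidendriform bialgebra and vanish on every $\bullet_d$, the canonical map $\mathcal A^D\oplus K\to\mathcal H^D$, $(a,s)\mapsto a+s1$, is bijective and compatible with products, units, coproducts and counits, where $\mathcal A^D\oplus K$ has the unital product that extends $a\prec b+a\succ b$, the coproduct with $1\mapsto 1\otimes 1$ and $a\mapsto a\otimes 1+1\otimes a+\Delta_\prec(a)+\Delta_\succ(a)$, and the counit $(a,s)\mapsto s$. -/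

import Mathlib

open scoped TensorProduct

universe u v

noncomputable section

/-! ### Dendriform algebras and coalgebras, bidendriform bialgebras -/

section Dendriform

variable {K : Type u} [Field K] {A : Type v} [AddCommGroup A] [Module K A]

/-- `(A, ≺, ≻)` is a dendriform algebra. -/
structure IsDendriformAlgebra (prec succ : A →ₗ[K] A →ₗ[K] A) : Prop where
  prec_prec : ∀ a b c, prec (prec a b) c = prec a (prec b c + succ b c)
  succ_prec : ∀ a b c, prec (succ a b) c = succ a (prec b c)
  mul_succ : ∀ a b c, succ (prec a b + succ a b) c = succ a (succ b c)

/-- `(A, Δ_≺, Δ_≻)` is a dendriform coalgebra; the triple tensor products are identified through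
the associator. -/
structure IsDendriformCoalgebra (dL dR : A →ₗ[K] A ⊗[K] A) : Prop where
  left_left : ∀ a, TensorProduct.assoc K A A A (dL.rTensor A (dL a)) =
    (dL.lTensor A + dR.lTensor A) (dL a)
  right_left : ∀ a, TensorProduct.assoc K A A A (dR.rTensor A (dL a)) = dL.lTensor A (dR a)
  sum_right : ∀ a, TensorProduct.assoc K A A A ((dL.rTensor A + dR.rTensor A) (dR a)) =
    dR.lTensor A (dR a)

/-- `(A, ≺, ≻, Δ_≺, Δ_≻)` is a bidendriform bialgebra. With `ab = a ≺ b + a ≻ b` and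
`(Δ_≺ + Δ_≻)(a) = a' ⊗ a''`, the compatibilities read, in Sweedler's notation,
* `Δ_≻(a ≻ b) = a'b'_≻ ⊗ a''≻b''_≻ + a' ⊗ a''≻b + b'_≻ ⊗ a≻b''_≻ + ab'_≻ ⊗ b''_≻ + a ⊗ b`,
* `Δ_≻(a ≺ b) = a'b'_≻ ⊗ a''≺b''_≻ + a' ⊗ a''≺b + b'_≻ ⊗ a≺b''_≻`,
* `Δ_≺(a ≻ b) = a'b'_≺ ⊗ a''≻b''_≺ + ab'_≺ ⊗ b''_≺ + b'_≺ ⊗ a≻b''_≺`,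
* `Δ_≺(a ≺ b) = a'b'_≺ ⊗ a''≺b''_≺ + a'b ⊗ a'' + b'_≺ ⊗ a≺b''_≺ + b ⊗ a`.

Here `TensorProduct.map₂ f g (x ⊗ y) (z ⊗ w) = f x z ⊗ g y w`. -/
structure IsBidendriformBialgebra (prec succ : A →ₗ[K] A →ₗ[K] A)
    (dL dR : A →ₗ[K] A ⊗[K] A) : Prop where
  dendriformAlgebra : IsDendriformAlgebra prec succ
  dendriformCoalgebra : IsDendriformCoalgebra dL dR
  right_succ : ∀ a b, dR (succ a b) =
    TensorProduct.map₂ (prec + succ) succ ((dL + dR) a) (dR b)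
      + (succ.flip b).lTensor A ((dL + dR) a)
      + (succ a).lTensor A (dR b)
      + ((prec + succ) a).rTensor A (dR b)
      + a ⊗ₜ[K] b
  right_prec : ∀ a b, dR (prec a b) =
    TensorProduct.map₂ (prec + succ) prec ((dL + dR) a) (dR b)
      + (prec.flip b).lTensor A ((dL + dR) a)
      + (prec a).lTensor A (dR b)
  left_succ : ∀ a b, dL (succ a b) =
    TensorProduct.map₂ (prec + succ) succ ((dL + dR) a) (dL b)
      + ((prec + succ) a).rTensor A (dL b)
      + (succ a).lTensor A (dL b)
  left_prec : ∀ a b, dL (prec a b) =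
    TensorProduct.map₂ (prec + succ) prec ((dL + dR) a) (dL b)
      + ((prec + succ).flip b).rTensor A ((dL + dR) a)
      + (prec a).lTensor A (dL b)
      + b ⊗ₜ[K] a

/-- The unital product on `A ⊕ K` extending a product on `A`:
`(a, s)(b, t) = (ab + s b + t a, s t)`. -/
def unitMul (mul : A →ₗ[K] A →ₗ[K] A) : (A × K) →ₗ[K] (A × K) →ₗ[K] (A × K) :=
  LinearMap.mk₂ K (fun x y => (mul x.1 y.1 + x.2 • y.1 + y.2 • x.1, x.2 * y.2))
    (by intro x x' y; ext <;> simp [add_smul, add_mul]; abel)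
    (by intro c x y; ext <;> simp [mul_smul, mul_assoc, smul_comm c])
    (by intro x y y'; ext <;> simp [add_smul, mul_add]; abel)
    (by intro c x y; ext <;> simp [mul_smul, mul_left_comm, smul_comm c])

/-- The counital coproduct on `A ⊕ K` extending a coproduct `δ` on `A`:
`Δ(1) = 1 ⊗ 1` and `Δ(a) = 1 ⊗ a + a ⊗ 1 + δ(a)`, where `1 = (0, 1)`. -/
def unitComul (δ : A →ₗ[K] A ⊗[K] A) : (A × K) →ₗ[K] (A × K) ⊗[K] (A × K) :=
  LinearMap.coprod
    (TensorProduct.mk K (A × K) (A × K) (0, 1) ∘ₗ LinearMap.inl K A K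
      + (TensorProduct.mk K (A × K) (A × K)).flip (0, 1) ∘ₗ LinearMap.inl K A K
      + TensorProduct.map (LinearMap.inl K A K) (LinearMap.inl K A K) ∘ₗ δ)
    (LinearMap.toSpanSingleton K _ ((0, 1) ⊗ₜ[K] (0, 1)))

end Dendriform

/-- The algebra `H`, with the coproduct `Δ` and the counit `ε`, is a Hopf algebra over `K`. -/
structure IsHopfAlgebra {K : Type u} [Field K] {H : Type v} [Ring H] [Algebra K H]
    (Δ : H →ₗ[K] H ⊗[K] H) (ε : H →ₗ[K] K) : Prop where
  coassoc : ∀ x, TensorProduct.assoc K H H H (Δ.rTensor H (Δ x)) = Δ.lTensor H (Δ x)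
  rTensor_counit : ∀ x, ε.rTensor H (Δ x) = 1 ⊗ₜ[K] x
  lTensor_counit : ∀ x, ε.lTensor H (Δ x) = x ⊗ₜ[K] 1
  comul_one : Δ 1 = 1
  comul_mul : ∀ x y, Δ (x * y) = Δ x * Δ y
  counit_one : ε 1 = 1
  counit_mul : ∀ x y, ε (x * y) = ε x * ε y
  antipode : ∃ S : H →ₗ[K] H, ∀ x,
    LinearMap.mul' K H (S.rTensor H (Δ x)) = algebraMap K H (ε x) ∧
    LinearMap.mul' K H (S.lTensor H (Δ x)) = algebraMap K H (ε x)

/-! ### Planar decorated rooted trees and forests, admissible cuts -/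

/-- Planar rooted trees with vertices decorated by `D`: a root decorated by `d` and the ordered
forest of the subtrees grafted on it. -/
inductive PlanarTree (D : Type v) : Type v
  | node (d : D) (F : List (PlanarTree D)) : PlanarTree D

namespace PlanarTree

variable {D : Type v}

/- A cut is encoded as a tree decorated by `D × Bool`: the mark of a vertex other than a root says
whether the edge that arrives at it from above is cut, and the mark of a root says whether the cut
is the total cut of its tree. -/

mutual
/-- All the cuts (sets of cut edges, each with or without a mark on the root) of a tree. -/
def cuts : PlanarTree D → List (PlanarTree (D × Bool))
  | node d F => (forestCuts F).flatMap fun G => [node (d, false) G, node (d, true) G]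
/-- All the cuts of a forest: tuples of cuts of its trees. -/
def forestCuts : List (PlanarTree D) → List (List (PlanarTree (D × Bool)))
  | [] => [[]]
  | t :: F => (cuts t).flatMap fun c => (forestCuts F).map fun C => c :: C
end

mutual
/-- No mark in the tree. -/
def unmarked : PlanarTree (D × Bool) → Bool
  | node db F => !db.2 && forestUnmarked F
/-- No mark in the forest. -/
def forestUnmarked : List (PlanarTree (D × Bool)) → Bool
  | [] => true
  | t :: F => unmarked t && forestUnmarked F
end

mutual
/-- Every path going down from the root meets at most one mark: there is no mark strictly below a
marked vertex. The admissible cuts so obtained are the empty cut, the total cut, and the nonempty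
sets of edges such that every path from the root meets at most one of them. -/
def admissible : PlanarTree (D × Bool) → Bool
  | node db F => forestAdmissible F && (!db.2 || forestUnmarked F)
/-- Every component of the cut of the forest is admissible. -/
def forestAdmissible : List (PlanarTree (D × Bool)) → Bool
  | [] => true
  | t :: F => admissible t && forestAdmissible F
end

mutual
/-- Forget the marks. -/
def forget : PlanarTree (D × Bool) → PlanarTree D
  | node db F => node db.1 (forestForget F)
/-- Forget the marks. -/
def forestForget : List (PlanarTree (D × Bool)) → List (PlanarTree D)
  | [] => []
  | t :: F => forget t :: forestForget F
end

mutual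
/-- The forest `P^c(t)` of what is cut off, in the planar order. -/
def pruned : PlanarTree (D × Bool) → List (PlanarTree D)
  | node db F => if db.2 then [node db.1 (forestForget F)] else forestPruned F
/-- `P^c(F) = P^{c₁}(t₁) ⋯ P^{cₙ}(tₙ)`. -/
def forestPruned : List (PlanarTree (D × Bool)) → List (PlanarTree D)
  | [] => []
  | t :: F => pruned t ++ forestPruned F
end

mutual
/-- `R^c(t)`: the component of the root, which is the empty forest for the total cut. -/
def remaining : PlanarTree (D × Bool) → List (PlanarTree D)
  | node db F => if db.2 then [] else [node db.1 (forestRemaining F)]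
/-- `R^c(F) = R^{c₁}(t₁) ⋯ R^{cₙ}(tₙ)`. -/
def forestRemaining : List (PlanarTree (D × Bool)) → List (PlanarTree D)
  | [] => []
  | t :: F => remaining t ++ forestRemaining F
end

/-- All the admissible cuts of a forest, the empty cut and the total cut included. -/
def admissibleCuts (F : List (PlanarTree D)) : List (List (PlanarTree (D × Bool))) :=
  (forestCuts F).filter forestAdmissible

end PlanarTree

/-! ### The Hopf algebra of planar decorated rooted trees -/

namespace CK

open PlanarTree

variable (K : Type u) [Field K] {D : Type v}

/-- The free associative unital `K`-algebra on the planar trees decorated by `D`; the planar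
forests (words in trees) form a basis. -/
abbrev H (K : Type u) [Field K] (D : Type v) : Type (max u v) :=
  MonoidAlgebra K (FreeMonoid (PlanarTree D))

/-- A planar forest as an element of the algebra. -/
def forest (F : List (PlanarTree D)) : H K D :=
  MonoidAlgebra.single (FreeMonoid.ofList F) 1

/-- The linear map with prescribed values on the basis of forests. -/
def extend {M : Type*} [AddCommGroup M] [Module K M] (f : List (PlanarTree D) → M) :
    H K D →ₗ[K] M :=
  (MonoidAlgebra.basis (FreeMonoid (PlanarTree D)) K).constr K fun w => f (FreeMonoid.toList w)

/-- The Connes–Kreimer coproduct `Δ(F) = ∑ P^c(F) ⊗ R^c(F)`, over all admissible cuts of `F`, the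
empty and the total ones included. -/
def comul : H K D →ₗ[K] H K D ⊗[K] H K D :=
  extend K fun F => ((admissibleCuts F).map fun c =>
    forest K (forestPruned c) ⊗ₜ[K] forest K (forestRemaining c)).sum

/-- The counit: `ε(1) = 1` and `ε(F) = 0` for a nonempty forest `F`. -/
def counit : H K D →ₗ[K] K :=
  extend K fun F => if F.isEmpty then 1 else 0

/-- The operator `B_d^+`, which grafts the trees of a forest on a common root decorated by `d`. -/
def graft (d : D) : H K D →ₗ[K] H K D :=
  extend K fun F => forest K [node d F]

/-- The left product `F ≺ x`, for a forest `F`: `1 ≺ x = 0`, and for a tree `t = B_d^+(G)`,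
`(t F) ≺ x = t (F ≺ x) + B_d^+(G (F x - F ≺ x))`. In particular `B_d^+(G) ≺ x = B_d^+(G x)`. -/
def forestPrec : List (PlanarTree D) → H K D →ₗ[K] H K D
  | [] => 0
  | node d G :: F =>
      LinearMap.mulLeft K (forest K [node d G]) ∘ₗ forestPrec F
        + graft K d ∘ₗ LinearMap.mulLeft K (forest K G) ∘ₗ
            (LinearMap.mulLeft K (forest K F) - forestPrec F)

/-- The left product on the whole algebra. -/
def precH : H K D →ₗ[K] H K D →ₗ[K] H K D := extend K (forestPrec K)

/-- The augmentation ideal. -/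
def augIdeal (K : Type u) [Field K] (D : Type v) : Submodule K (H K D) :=
  LinearMap.ker (counit K)

@[simp] lemma extend_forest {M : Type*} [AddCommGroup M] [Module K M]
    (f : List (PlanarTree D) → M) (F : List (PlanarTree D)) : extend K f (forest K F) = f F := by
  have h : forest K F =
      MonoidAlgebra.basis (FreeMonoid (PlanarTree D)) K (FreeMonoid.ofList F) := by
    simp [forest]
  rw [h, extend, Module.Basis.constr_basis]
  simp

lemma ext_forest {M : Type*} [AddCommGroup M] [Module K M] {f g : H K D →ₗ[K] M}
    (h : ∀ F, f (forest K F) = g (forest K F)) : f = g := by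
  refine (MonoidAlgebra.basis (FreeMonoid (PlanarTree D)) K).ext fun w => ?_
  simpa [forest] using h (FreeMonoid.toList w)

lemma forest_mul (F G : List (PlanarTree D)) : forest K F * forest K G = forest K (F ++ G) := by
  simp [forest, MonoidAlgebra.single_mul_single]

lemma forest_nil : forest K ([] : List (PlanarTree D)) = 1 := rfl

@[simp] lemma counit_forest (F : List (PlanarTree D)) :
    counit K (forest K F) = if F.isEmpty then 1 else 0 := by simp [counit]

lemma counit_mul (x y : H K D) : counit K (x * y) = counit K x * counit K y := by
  have : (LinearMap.mul K (H K D)).compr₂ (counit K) =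
      (LinearMap.mul K K).compl₁₂ (counit K) (counit K) := by
    refine ext_forest K fun F => ext_forest K fun G => ?_
    cases F <;> cases G <;> simp [forest_mul]
  exact LinearMap.congr_fun (LinearMap.congr_fun this x) y

lemma counit_graft (d : D) (x : H K D) : counit K (graft K d x) = 0 := by
  have : counit K ∘ₗ graft K d = 0 := ext_forest K fun F => by simp [graft]
  exact LinearMap.congr_fun this x

lemma counit_forestPrec (F : List (PlanarTree D)) (x : H K D) :
    counit K (forestPrec K F x) = 0 := by
  rcases F with _ | ⟨⟨d, G⟩, F⟩
  · simp [forestPrec]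
  · simp [forestPrec, counit_mul, counit_graft]

lemma counit_precH (x y : H K D) : counit K (precH K x y) = 0 := by
  have : (precH K).compr₂ (counit K) = (0 : H K D →ₗ[K] H K D →ₗ[K] K) :=
    ext_forest K fun F => LinearMap.ext fun z => by simp [precH, counit_forestPrec]
  exact LinearMap.congr_fun (LinearMap.congr_fun this x) y

variable (D)

/-- The left product `≺` of the dendriform algebra `A^D` (see `prec_unique`). -/
def prec : augIdeal K D →ₗ[K] augIdeal K D →ₗ[K] augIdeal K D :=
  LinearMap.mk₂ K (fun a b => ⟨precH K a.1 b.1, counit_precH K _ _⟩)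
    (by intros; ext1; simp) (by intros; ext1; simp) (by intros; ext1; simp)
    (by intros; ext1; simp)

/-- The right product `a ≻ b = a b - a ≺ b` of the dendriform algebra `A^D`. -/
def succ : augIdeal K D →ₗ[K] augIdeal K D →ₗ[K] augIdeal K D :=
  LinearMap.mk₂ K
    (fun a b => ⟨a.1 * b.1 - precH K a.1 b.1, by
      have ha : counit K a.1 = 0 := a.2
      simp [augIdeal, counit_mul, counit_precH, ha]⟩)
    (by intros; ext1; simp [add_mul]; abel) (by intros; ext1; simp [smul_sub])
    (by intros; ext1; simp [mul_add]; abel) (by intros; ext1; simp [smul_sub])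

/-- The projection `x ↦ x - ε(x) 1` of `H^D` onto its augmentation ideal. -/
def augProj : H K D →ₗ[K] augIdeal K D :=
  LinearMap.codRestrict (augIdeal K D)
    (LinearMap.id - LinearMap.toSpanSingleton K (H K D) 1 ∘ₗ counit K)
    (by
      intro x
      have h : counit K (1 : H K D) = 1 := by simp [← forest_nil]
      simp [augIdeal, h])

lemma augProj_coe (x : H K D) : (augProj K D x).1 = x - counit K x • 1 := rfl

/-- The reduced coproduct on `A^D`: the component in `A^D ⊗ A^D` of the coproduct
`Δ(a) = a ⊗ 1 + 1 ⊗ a + Δ̃(a)`. -/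
def redComul : augIdeal K D →ₗ[K] augIdeal K D ⊗[K] augIdeal K D :=
  TensorProduct.map (augProj K D) (augProj K D) ∘ₗ comul K ∘ₗ (augIdeal K D).subtype

variable {D}

/-- The tree with a single vertex, decorated by `d`. -/
def dot (d : D) : augIdeal K D :=
  ⟨forest K [node d []], by simp [augIdeal]⟩

/-- The dendriform structure above is the only one on the augmentation ideal for which `≺ + ≻` is
the product of `H^D` and `d ≺ x = B_d^+(x)` for every single vertex `d`. -/
theorem prec_unique {p s : augIdeal K D →ₗ[K] augIdeal K D →ₗ[K] augIdeal K D}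
    (h : IsDendriformAlgebra p s)
    (hmul : ∀ a b, (p a b).1 + (s a b).1 = a.1 * b.1)
    (hdot : ∀ d x, (p (dot K d) x).1 = graft K d x.1) : p = prec K D ∧ s = succ K D := by
  have hF : ∀ F : List (PlanarTree D), F ≠ [] → counit K (forest K F) = 0 := by
    intro F hF; cases F <;> simp_all
  have ht : ∀ d (G : List (PlanarTree D)) (a : augIdeal K D),
      a.1 = forest K [node d G] → ∀ x, (p a x).1 = graft K d (forest K G * x.1) := by
    intro d G a ha x
    rcases G with _ | ⟨t, G⟩
    · have : a = dot K d := Subtype.ext ha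
      rw [this, hdot, forest_nil, one_mul]
    · let g : augIdeal K D := ⟨forest K (t :: G), hF _ (by simp)⟩
      have : a = p (dot K d) g := by
        apply Subtype.ext
        rw [hdot, ha]; simp [g, graft]
      rw [this, h.prec_prec, hdot]
      congr 1
      exact hmul g x
  have hforest : ∀ F : List (PlanarTree D), ∀ a : augIdeal K D, F ≠ [] → a.1 = forest K F →
      ∀ x, (p a x).1 = forestPrec K F x.1 := by
    intro F
    induction F with
    | nil => intro a h; exact absurd rfl h
    | cons t F ih =>
      intro a _ ha x
      obtain ⟨d, G⟩ := t
      rcases F with _ | ⟨t', F⟩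
      · rw [ht d G a ha]; simp [forestPrec, forest_nil]
      · let g : augIdeal K D := ⟨forest K (t' :: F), hF _ (by simp)⟩
        let t : augIdeal K D := ⟨forest K [node d G], hF _ (by simp)⟩
        have hg := ih g (by simp) rfl x
        have e1 : a = p t g + s t g := by
          apply Subtype.ext
          rw [Submodule.coe_add, hmul, ha]; simp [t, g, forest_mul]
        have e2 : (p a x).1 = (p t (p g x + s g x)).1 + (s t (p g x)).1 := by
          rw [e1, map_add, LinearMap.add_apply, h.prec_prec, h.succ_prec]; rfl
        have e3 := hmul t (p g x)
        rw [e2, eq_sub_of_add_eq' e3, map_add]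
        have e4 := ht d G t rfl (s g x)
        have e5 : (s g x).1 = forest K (t' :: F) * x.1 - forestPrec K (t' :: F) x.1 := by
          rw [← hg]; exact eq_sub_iff_add_eq'.mpr (hmul g x)
        rw [e5] at e4
        rw [Submodule.coe_add, e4, hg]
        conv_rhs => rw [forestPrec]
        simp [t]
        abel
  have hp : ∀ a x : augIdeal K D, (p a x).1 = precH K a.1 x.1 := by
    intro a x
    have key : (augIdeal K D).subtype ∘ₗ p.flip x ∘ₗ augProj K D = (precH K).flip x.1 := by
      refine ext_forest K fun F => ?_
      rcases F with _ | ⟨t, F⟩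
      · have : augProj K D (forest K []) = 0 := by
          apply Subtype.ext; rw [augProj_coe, counit_forest]; simp [forest_nil]
        simp [this, precH, forestPrec]
      · have : (augProj K D (forest K (t :: F))).1 = forest K (t :: F) := by
          rw [augProj_coe]; simp
        simpa [precH] using hforest (t :: F) _ (by simp) this x
    have ha : augProj K D a.1 = a := by
      have h0 : counit K a.1 = 0 := a.2
      apply Subtype.ext; rw [augProj_coe, h0]; simp
    simpa [ha] using LinearMap.congr_fun key a.1
  refine ⟨LinearMap.ext₂ fun a x => Subtype.ext (hp a x), LinearMap.ext₂ fun a x => ?_⟩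
  apply Subtype.ext
  change _ = a.1 * x.1 - precH K a.1 x.1
  rw [← hp, ← hmul]; abel

variable (D)

/-- The canonical map `A^D ⊕ K → H^D`, `(a, s) ↦ a + s 1`. -/
def fromUnit : (augIdeal K D × K) →ₗ[K] H K D :=
  LinearMap.coprod (augIdeal K D).subtype (LinearMap.toSpanSingleton K (H K D) 1)

/-- `H^D` with the Connes–Kreimer coproduct is a Hopf algebra, and the Hopf algebra structure on
`A^D ⊕ K` given by the product `≺ + ≻` and the coproduct `Δ_≺ + Δ_≻` is the one of `H^D`: the
canonical map `A^D ⊕ K → H^D` is an isomorphism compatible with products, units, coproducts and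
counits. -/
structure InducesHopfStructure (prec succ : augIdeal K D →ₗ[K] augIdeal K D →ₗ[K] augIdeal K D)
    (dL dR : augIdeal K D →ₗ[K] augIdeal K D ⊗[K] augIdeal K D) : Prop where
  isHopfAlgebra : IsHopfAlgebra (comul K : H K D →ₗ[K] H K D ⊗[K] H K D) (counit K)
  bijective : Function.Bijective (fromUnit K D)
  map_mul : ∀ x y, fromUnit K D (unitMul (prec + succ) x y) = fromUnit K D x * fromUnit K D y
  map_one : fromUnit K D (0, 1) = 1
  map_comul : ∀ x, TensorProduct.map (fromUnit K D) (fromUnit K D) (unitComul (dL + dR) x) =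
    comul K (fromUnit K D x)
  map_counit : ∀ x, counit K (fromUnit K D x) = x.2

end CK

end

/-!
The coproduct of a planar forest is a sum over admissible cuts, and every forest has a last leaf:
the leaf reached from its last root by going down through the last children. The cuts that prune
this leaf give `Δ_≺`, and those that keep it give `Δ_≻`.

The proofs take place on the whole algebra `H`, where the conventions `1 ≺ x = 0`, `1 ≻ x = x`,
`Δ_≺(1) = 0`, `Δ_≻(1) = 1 ⊗ 1`, with the total cut counted in `Δ_≺` and the empty one in `Δ_≻`, turn
the long identities into short ones. On `H` the coproduct is multiplicative and `B = B_d^+` is a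
cocycle, `Δ(B x) = B x ⊗ 1 + (id ⊗ B) Δ(x)`. The half coproducts satisfy
`Δ_≺(B x) = B x ⊗ 1 + (id ⊗ B) Δ_≺(x)` and `Δ_≻(B x) = (id ⊗ B) Δ_≻(x)`, and the products
`Δ_≺(x y) = Δ(x) Δ_≺(y)`, `Δ_≻(x y) = Δ(x) Δ_≻(y)` if `ε(y) = 0`. As `H` is spanned from `1` by the
operations `(x, y) ↦ B_d^+(x) y` (`graft_induction`), everything follows by induction:
* the dendriform axioms, from `(x y) ≺ z = x (y ≺ z) + x ≺ (y ≻ z)` (`precH_mul`, `precH_precH`);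
* the coalgebra axioms `comulL_comulL`, `comulR_comulL`, `comul_comulR`;
* the compatibilities, in the form `Δ_≻(a ≺ b) = Δ(a) ≺ Δ_≻(b)` and
  `Δ_≺(a ≺ b) = Δ(a) ≺ Δ_≺(b) + (a ≺ b) ⊗ 1` (`comulR_precH`, `comulL_precH`); those for `≻` follow
  by subtraction from the multiplicativity.

Projection of `H` onto the augmentation ideal along `1` gives the bidendriform structure
(`isBidendriformBialgebra`). It is unique because the single vertices generate the ideal as a
dendriform algebra (`dendriform_induction`) and the compatibilities compute both coproducts at
`a ≺ b` and `a ≻ b` from those of `a` and `b` (`comul_unique`). In particular any bidendriform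
structure that vanishes on the vertices has `Δ_≺ + Δ_≻ = Δ̃`, which makes the canonical map
`A ⊕ K → H` compatible with the coproducts.

The antipode is the geometric series of `η ∘ ε - id` for the convolution product. It is a finite sum
on each forest, because the coproduct preserves the number of vertices.
-/

noncomputable section

/-! ### Antipodes from locally nilpotent convolution powers -/

section Antipode

open WithConv

variable {K : Type u} [Field K] {H : Type v} [Ring H] [Algebra K H]

/-- If `N = η ∘ ε - id` is locally nilpotent for the convolution product, then the identity is
convolution invertible: its inverse is the geometric series of `N`, a finite sum at each
element. -/
theorem exists_antipode_of_nilpotent [Coalgebra K H]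
    (hN : ∀ x : H, ∃ n, ∀ m ≥ n,
      ((1 - toConv LinearMap.id : WithConv (H →ₗ[K] H)) ^ m).ofConv x = 0) :
    ∃ S : H →ₗ[K] H, toConv S * toConv LinearMap.id = 1 ∧ toConv LinearMap.id * toConv S = 1 := by
  set N : WithConv (H →ₗ[K] H) := 1 - toConv LinearMap.id with hNdef
  have hid : (toConv LinearMap.id : WithConv (H →ₗ[K] H)) = 1 - N := by simp [hNdef]
  choose n hn using hN
  have hfin : ∀ x, (Function.support fun k => (N ^ k).ofConv x).Finite := fun x =>
    (Set.finite_lt_nat (n x)).subset fun k hk => by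
      by_contra h
      exact hk (hn x k (not_lt.mp h))
  let S : H →ₗ[K] H :=
    { toFun := fun x => ∑ᶠ k, (N ^ k).ofConv x
      map_add' := fun x y => by
        simp only [map_add]
        exact finsum_add_distrib (hfin x) (hfin y)
      map_smul' := fun c x => by
        simp only [map_smul, RingHom.id_apply]
        exact (smul_finsum' c (hfin x)).symm }
  have hS : ∀ x, ∀ m ≥ n x, S x = (∑ k ∈ Finset.range m, N ^ k).ofConv x := by
    intro x m hm
    have : S x = ∑ k ∈ Finset.range m, (N ^ k).ofConv x := by
      refine finsum_eq_sum_of_support_subset _ fun k hk => ?_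
      by_contra h
      have h' : m ≤ k := by simpa using h
      exact hk (hn x k (hm.trans h'))
    rw [this]
    simp [LinearMap.sum_apply]
  -- On an element of `H ⊗ H`, a sum of finitely many pure tensors, a single partial sum of the
  -- series may replace `S`; the telescoping identity of geometric sums then applies.
  have hL : ∀ X : H ⊗[K] H, ∃ m₀, ∀ m ≥ m₀, TensorProduct.map S LinearMap.id X =
      TensorProduct.map (∑ k ∈ Finset.range m, N ^ k).ofConv LinearMap.id X := by
    intro X
    induction X with
    | zero => exact ⟨0, by simp⟩
    | tmul x y => exact ⟨n x, fun m hm => by simp only [TensorProduct.map_tmul, hS x m hm]⟩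
    | add X Y hX hY =>
      obtain ⟨a, ha⟩ := hX
      obtain ⟨b, hb⟩ := hY
      exact ⟨max a b, fun m hm => by
        rw [map_add, map_add, ha m (le_of_max_le_left hm), hb m (le_of_max_le_right hm)]⟩
  have hR : ∀ X : H ⊗[K] H, ∃ m₀, ∀ m ≥ m₀, TensorProduct.map LinearMap.id S X =
      TensorProduct.map LinearMap.id (∑ k ∈ Finset.range m, N ^ k).ofConv X := by
    intro X
    induction X with
    | zero => exact ⟨0, by simp⟩
    | tmul x y => exact ⟨n y, fun m hm => by simp only [TensorProduct.map_tmul, hS y m hm]⟩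
    | add X Y hX hY =>
      obtain ⟨a, ha⟩ := hX
      obtain ⟨b, hb⟩ := hY
      exact ⟨max a b, fun m hm => by
        rw [map_add, map_add, ha m (le_of_max_le_left hm), hb m (le_of_max_le_right hm)]⟩
  refine ⟨S, ?_, ?_⟩
  · ext x
    obtain ⟨m₀, hm₀⟩ := hL (Coalgebra.comul x)
    have e := hm₀ (max m₀ (n x)) (le_max_left _ _)
    have e' : (toConv S * toConv LinearMap.id : WithConv (H →ₗ[K] H)).ofConv x =
        ((∑ k ∈ Finset.range (max m₀ (n x)), N ^ k) * toConv LinearMap.id).ofConv x := by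
      rw [LinearMap.convMul_apply, LinearMap.convMul_apply]
      exact congrArg _ e
    refine e'.trans ?_
    rw [hid, geom_sum_mul_neg]
    simp [hn x _ (le_max_right m₀ (n x))]
  · ext x
    obtain ⟨m₀, hm₀⟩ := hR (Coalgebra.comul x)
    have e := hm₀ (max m₀ (n x)) (le_max_left _ _)
    have e' : (toConv LinearMap.id * toConv S : WithConv (H →ₗ[K] H)).ofConv x =
        (toConv LinearMap.id * (∑ k ∈ Finset.range (max m₀ (n x)), N ^ k)).ofConv x := by
      rw [LinearMap.convMul_apply, LinearMap.convMul_apply]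
      exact congrArg _ e
    refine e'.trans ?_
    rw [hid, mul_neg_geom_sum]
    simp [hn x _ (le_max_right m₀ (n x))]

/-- The convolution powers of `η ∘ ε - id`, where `η` is the unit of the algebra. -/
def convPow (Δ : H →ₗ[K] H ⊗[K] H) (ε : H →ₗ[K] K) : ℕ → H →ₗ[K] H
  | 0 => Algebra.linearMap K H ∘ₗ ε
  | n + 1 => LinearMap.mul' K H ∘ₗ
      TensorProduct.map (convPow Δ ε n) (Algebra.linearMap K H ∘ₗ ε - LinearMap.id) ∘ₗ Δ

theorem exists_antipode {Δ : H →ₗ[K] H ⊗[K] H} {ε : H →ₗ[K] K}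
    (coassoc : ∀ x, TensorProduct.assoc K H H H (Δ.rTensor H (Δ x)) = Δ.lTensor H (Δ x))
    (rTensor_counit : ∀ x, ε.rTensor H (Δ x) = 1 ⊗ₜ[K] x)
    (lTensor_counit : ∀ x, ε.lTensor H (Δ x) = x ⊗ₜ[K] 1)
    (hN : ∀ x, ∃ n, ∀ m ≥ n, convPow Δ ε m x = 0) :
    ∃ S : H →ₗ[K] H, ∀ x,
      LinearMap.mul' K H (S.rTensor H (Δ x)) = algebraMap K H (ε x) ∧
      LinearMap.mul' K H (S.lTensor H (Δ x)) = algebraMap K H (ε x) := by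
  let _ : Coalgebra K H :=
    { comul := Δ
      counit := ε
      coassoc := LinearMap.ext coassoc
      rTensor_counit_comp_comul := LinearMap.ext rTensor_counit
      lTensor_counit_comp_comul := LinearMap.ext lTensor_counit }
  have hpow : ∀ n, ((1 - toConv LinearMap.id : WithConv (H →ₗ[K] H)) ^ n).ofConv =
      convPow Δ ε n := by
    intro n
    induction n with
    | zero => rfl
    | succ n ih =>
      rw [pow_succ, convPow, ← ih]
      rfl
  obtain ⟨S, h1, h2⟩ := exists_antipode_of_nilpotent (K := K) (H := H) fun x => by
    simpa only [hpow] using hN x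
  refine ⟨S, fun x => ⟨?_, ?_⟩⟩
  · exact LinearMap.congr_fun (congrArg ofConv h1) x
  · exact LinearMap.congr_fun (congrArg ofConv h2) x

end Antipode

/-! ### Sums over the cuts of a forest -/

namespace PlanarTree

variable {D : Type v} {M : Type*} [AddCommMonoid M]

lemma sum_cuts_node (d : D) (F : List (PlanarTree D)) (g : PlanarTree (D × Bool) → M) :
    ((cuts (node d F)).map g).sum =
      ((forestCuts F).map fun C => g (node (d, false) C) + g (node (d, true) C)).sum := by
  rw [cuts]
  induction forestCuts F with
  | nil => simp
  | cons C L ih => simp_all [add_assoc]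

lemma sum_forestCuts_cons (t : PlanarTree D) (F : List (PlanarTree D))
    (g : List (PlanarTree (D × Bool)) → M) :
    ((forestCuts (t :: F)).map g).sum =
      ((cuts t).map fun c => ((forestCuts F).map fun C => g (c :: C)).sum).sum := by
  rw [forestCuts]
  induction cuts t with
  | nil => simp
  | cons c L ih => simp_all [Function.comp_def]

lemma sum_map_filter {ι : Type*} (L : List ι) (p : ι → Bool) (g : ι → M) :
    ((L.filter p).map g).sum = (L.map fun i => if p i then g i else 0).sum := by
  induction L with
  | nil => simp
  | cons i L ih => by_cases h : p i <;> simp [h, ih]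

mutual
/-- Exactly one of the cuts of a tree, with or without a mark on the root, has no mark at all: the
empty one. -/
lemma sum_cuts_unmarked (g : PlanarTree D → M) : ∀ t : PlanarTree D,
    ((cuts t).map fun c => if unmarked c then g (forget c) else 0).sum = g t
  | node d F => by
    rw [sum_cuts_node]
    simpa [unmarked, forget] using sum_forestCuts_unmarked (fun F => g (node d F)) F
lemma sum_forestCuts_unmarked (g : List (PlanarTree D) → M) : ∀ F : List (PlanarTree D),
    ((forestCuts F).map fun C => if forestUnmarked C then g (forestForget C) else 0).sum = g F
  | [] => by simp [forestCuts, forestUnmarked, forestForget]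
  | t :: F => by
    rw [sum_forestCuts_cons, ← sum_cuts_unmarked (fun t => g (t :: F)) t]
    congr 1
    refine List.map_congr_left fun c _ => ?_
    rw [← sum_forestCuts_unmarked (fun F => g (forget c :: F)) F]
    by_cases h : unmarked c <;> simp [forestUnmarked, forestForget, h]
end

mutual
lemma admissible_of_unmarked : ∀ c : PlanarTree (D × Bool), unmarked c → admissible c
  | node (d, b) C => by
    have := forestAdmissible_of_unmarked C
    simp only [unmarked, admissible]
    grind
lemma forestAdmissible_of_unmarked : ∀ C : List (PlanarTree (D × Bool)),
    forestUnmarked C → forestAdmissible C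
  | [] => by simp [forestAdmissible]
  | c :: C => by
    have := admissible_of_unmarked c
    have := forestAdmissible_of_unmarked C
    simp only [forestUnmarked, forestAdmissible]
    grind
end

mutual
/-- The number of vertices of a tree. -/
def size : PlanarTree D → ℕ
  | node _ F => forestSize F + 1
/-- The number of vertices of a forest. -/
def forestSize : List (PlanarTree D) → ℕ
  | [] => 0
  | t :: F => size t + forestSize F
end

lemma forestSize_append (F G : List (PlanarTree D)) :
    forestSize (F ++ G) = forestSize F + forestSize G := by
  induction F with
  | nil => simp [forestSize]
  | cons t F ih => simp [forestSize, ih, add_assoc]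

lemma forestSize_pos {F : List (PlanarTree D)} (h : F ≠ []) : 0 < forestSize F := by
  rcases F with _ | ⟨⟨d, G⟩, F⟩
  · exact absurd rfl h
  · simp [forestSize, size]

mutual
lemma forget_of_mem_cuts : ∀ (t : PlanarTree D), ∀ c ∈ cuts t, forget c = t
  | node d F => by
    intro c hc
    simp only [cuts, List.mem_flatMap, List.mem_cons, List.not_mem_nil, or_false] at hc
    obtain ⟨C, hC, rfl | rfl⟩ := hc <;> simp [forget, forestForget_of_mem_forestCuts F C hC]
lemma forestForget_of_mem_forestCuts : ∀ (F : List (PlanarTree D)), ∀ C ∈ forestCuts F,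
    forestForget C = F
  | [] => by simp [forestCuts, forestForget]
  | t :: F => by
    intro C hC
    simp only [forestCuts, List.mem_flatMap, List.mem_map] at hC
    obtain ⟨c, hc, C, hC, rfl⟩ := hC
    simp [forestForget, forget_of_mem_cuts t c hc, forestForget_of_mem_forestCuts F C hC]
end

mutual
lemma size_pruned_add_size_remaining : ∀ c : PlanarTree (D × Bool),
    forestSize (pruned c) + forestSize (remaining c) = size (forget c)
  | node (d, b) C => by
    have := forestSize_pruned_add_forestSize_remaining C
    cases b
    · simp only [pruned, remaining, forget, size, forestSize, Bool.false_eq_true, if_false]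
      omega
    · simp [pruned, remaining, forget, size, forestSize]
lemma forestSize_pruned_add_forestSize_remaining : ∀ C : List (PlanarTree (D × Bool)),
    forestSize (forestPruned C) + forestSize (forestRemaining C) = forestSize (forestForget C)
  | [] => by simp [forestPruned, forestRemaining, forestForget, forestSize]
  | c :: C => by
    have := size_pruned_add_size_remaining c
    have := forestSize_pruned_add_forestSize_remaining C
    simp only [forestPruned, forestRemaining, forestForget, forestSize, forestSize_append]
    omega
end

end PlanarTree

/-! ### Tensor calculus -/

section TensorCalculus

variable {K : Type u} [Field K] {H B : Type*} [Ring H] [Algebra K H] [Ring B] [Algebra K B]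

/-- A map that is multiplicative relative to `g`, up to a term carried by `ε`, has the same property
on a tensor product, the correction being governed by the partial evaluation `ε ⊗ id`. -/
lemma rTensor_mul_of_mul {f g h : H →ₗ[K] B} {ε : H →ₗ[K] K}
    (hf : ∀ x y, f (x * y) = g x * f y + ε y • h x) {C : Type*} [Ring C] [Algebra K C]
    (X Y : H ⊗[K] C) : f.rTensor C (X * Y) = g.rTensor C X * f.rTensor C Y +
      h.rTensor C X * (Algebra.linearMap K B).rTensor C (ε.rTensor C Y) := by
  induction X with
  | zero => simp
  | add X X' hX hX' => simp only [add_mul, map_add, hX, hX']; abel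
  | tmul x c =>
    induction Y with
    | zero => simp
    | add Y Y' hY hY' => simp only [mul_add, map_add, hY, hY']; abel
    | tmul y c' =>
      simp [hf, TensorProduct.add_tmul, ← Algebra.commutes (ε y) (h x), Algebra.smul_def]

lemma lTensor_mul_of_mul {f g h : H →ₗ[K] B} {ε : H →ₗ[K] K}
    (hf : ∀ x y, f (x * y) = g x * f y + ε y • h x) {C : Type*} [Ring C] [Algebra K C]
    (X Y : C ⊗[K] H) : f.lTensor C (X * Y) = g.lTensor C X * f.lTensor C Y +
      h.lTensor C X * (Algebra.linearMap K B).lTensor C (ε.lTensor C Y) := by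
  induction X with
  | zero => simp
  | add X X' hX hX' => simp only [add_mul, map_add, hX, hX']; abel
  | tmul x c =>
    induction Y with
    | zero => simp
    | add Y Y' hY hY' => simp only [mul_add, map_add, hY, hY']; abel
    | tmul y c' =>
      simp [hf, TensorProduct.tmul_add, ← Algebra.commutes (ε c') (h c), ← Algebra.smul_def]

lemma rTensor_mul_of_map_mul {f : H →ₗ[K] B} (hf : ∀ x y, f (x * y) = f x * f y)
    {C : Type*} [Ring C] [Algebra K C] (X Y : H ⊗[K] C) :
    f.rTensor C (X * Y) = f.rTensor C X * f.rTensor C Y := by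
  simpa using rTensor_mul_of_mul (f := f) (g := f) (h := 0) (ε := 0) (by simpa using hf) X Y

lemma lTensor_mul_of_map_mul {f : H →ₗ[K] B} (hf : ∀ x y, f (x * y) = f x * f y)
    {C : Type*} [Ring C] [Algebra K C] (X Y : C ⊗[K] H) :
    f.lTensor C (X * Y) = f.lTensor C X * f.lTensor C Y := by
  simpa using lTensor_mul_of_mul (f := f) (g := f) (h := 0) (ε := 0) (by simpa using hf) X Y

lemma assoc_mul (X Y : (H ⊗[K] H) ⊗[K] H) : TensorProduct.assoc K H H H (X * Y) =
    TensorProduct.assoc K H H H X * TensorProduct.assoc K H H H Y :=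
  map_mul (Algebra.TensorProduct.assoc K K K H H H) X Y

lemma assoc_rTensor_lTensor (δ : H →ₗ[K] H ⊗[K] H) (β : H →ₗ[K] H) (X : H ⊗[K] H) :
    TensorProduct.assoc K H H H (δ.rTensor H (β.lTensor H X)) =
      (β.lTensor H).lTensor H (TensorProduct.assoc K H H H (δ.rTensor H X)) := by
  induction X with
  | zero => simp
  | add X X' hX hX' => simp only [map_add, hX, hX']
  | tmul x y =>
    simp only [LinearMap.lTensor_tmul, LinearMap.rTensor_tmul]
    induction δ x with
    | zero => simp
    | add X X' hX hX' => simp only [TensorProduct.add_tmul, map_add, hX, hX']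
    | tmul z w => simp

lemma assoc_tmul_one (X : H ⊗[K] H) : TensorProduct.assoc K H H H (X ⊗ₜ[K] 1) =
    ((TensorProduct.mk K H H).flip 1).lTensor H X := by
  induction X with
  | zero => simp
  | add X X' hX hX' => simp only [TensorProduct.add_tmul, map_add, hX, hX']
  | tmul z w => simp

/-- The cocycle property of `β` with respect to `δ`, applied to the second factor of `H ⊗ H`. -/
lemma lTensor_lTensor_of_cocycle {δ : H →ₗ[K] H ⊗[K] H} {β : H →ₗ[K] H}
    (h : ∀ x, δ (β x) = β x ⊗ₜ[K] 1 + β.lTensor H (δ x)) (X : H ⊗[K] H) :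
    δ.lTensor H (β.lTensor H X) = ((TensorProduct.mk K H H).flip 1).lTensor H (β.lTensor H X) +
      (β.lTensor H).lTensor H (δ.lTensor H X) := by
  induction X with
  | zero => simp
  | add X X' hX hX' => simp only [map_add, hX, hX']; abel
  | tmul x y => simp [h, TensorProduct.tmul_add]

end TensorCalculus

namespace CK

open PlanarTree

variable (K : Type u) [Field K] {D : Type v}

/-! ### The coproduct as a cocycle -/

lemma comul_forest (F : List (PlanarTree D)) : comul K (forest K F) =
    ((forestCuts F).map fun c => if forestAdmissible c then
      forest K (forestPruned c) ⊗ₜ[K] forest K (forestRemaining c) else 0).sum := by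
  rw [comul, extend_forest, admissibleCuts, sum_map_filter]

lemma comul_one : comul K (1 : H K D) = 1 := by
  rw [← forest_nil, comul_forest]
  simp [forestCuts, forestAdmissible, forestPruned, forestRemaining, forest_nil,
    Algebra.TensorProduct.one_def]

lemma comul_forest_singleton (t : PlanarTree D) : comul K (forest K [t]) =
    ((cuts t).map fun c => if admissible c then
      forest K (pruned c) ⊗ₜ[K] forest K (remaining c) else 0).sum := by
  rw [comul_forest, sum_forestCuts_cons]
  simp [forestCuts, forestAdmissible, forestPruned, forestRemaining]

lemma comul_forest_cons (t : PlanarTree D) (F : List (PlanarTree D)) :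
    comul K (forest K (t :: F)) = comul K (forest K [t]) * comul K (forest K F) := by
  rw [comul_forest_singleton, comul_forest, comul_forest, sum_forestCuts_cons,
    ← List.sum_map_mul_right]
  congr 1
  refine List.map_congr_left fun c _ => ?_
  rw [← List.sum_map_mul_left]
  congr 1
  refine List.map_congr_left fun C _ => ?_
  by_cases h : admissible c <;> by_cases h' : forestAdmissible C <;>
    simp [forestAdmissible, forestPruned, forestRemaining, h, h', forest_mul]

lemma comul_mul (x y : H K D) : comul K (x * y) = comul K x * comul K y := by
  have : (LinearMap.mul K (H K D)).compr₂ (comul K) =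
      (LinearMap.mul K (H K D ⊗[K] H K D)).compl₁₂ (comul K) (comul K) := by
    refine ext_forest K fun F => ext_forest K fun G => ?_
    simp only [LinearMap.compr₂_apply, LinearMap.mul_apply', LinearMap.compl₁₂_apply, forest_mul]
    induction F with
    | nil => simp [forest_nil, comul_one]
    | cons t F ih =>
      rw [List.cons_append, comul_forest_cons, ih, comul_forest_cons K t F, mul_assoc]
  exact LinearMap.congr_fun (LinearMap.congr_fun this x) y

/-- The coproduct is determined by this cocycle property: an admissible cut of `B_d^+(F)` is the
total one or comes from an admissible cut of `F`. -/
lemma comul_graft (d : D) (x : H K D) : comul K (graft K d x) =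
    graft K d x ⊗ₜ[K] 1 + (graft K d).lTensor (H K D) (comul K x) := by
  have : comul K ∘ₗ graft K d = (TensorProduct.mk K (H K D) (H K D)).flip 1 ∘ₗ graft K d +
      (graft K d).lTensor (H K D) ∘ₗ comul K := by
    refine ext_forest K fun F => ?_
    simp only [LinearMap.comp_apply, LinearMap.add_apply, graft, extend_forest]
    rw [comul_forest_singleton, sum_cuts_node, List.sum_map_add, add_comm]
    congr 1
    · simp only [LinearMap.flip_apply, TensorProduct.mk_apply]
      rw [← sum_forestCuts_unmarked (fun F => forest K [node d F] ⊗ₜ[K] (1 : H K D)) F]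
      congr 1
      refine List.map_congr_left fun C _ => ?_
      have := forestAdmissible_of_unmarked C
      by_cases h : forestUnmarked C <;> simp_all [admissible, pruned, remaining, forest_nil]
    · rw [comul_forest, map_list_sum, List.map_map]
      congr 1
      refine List.map_congr_left fun C _ => ?_
      by_cases h : forestAdmissible C <;> simp [admissible, pruned, remaining, h]
  exact LinearMap.congr_fun this x

/-! ### The dendriform algebra of forests -/

mutual
lemma tree_induction_aux {P : List (PlanarTree D) → Prop} (nil : P [])
    (cons : ∀ d G F, P G → P F → P (node d G :: F)) : ∀ t : PlanarTree D, ∀ F, P F → P (t :: F)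
  | node d G => fun F hF => cons d G F (forest_induction_aux nil cons G) hF
lemma forest_induction_aux {P : List (PlanarTree D) → Prop} (nil : P [])
    (cons : ∀ d G F, P G → P F → P (node d G :: F)) : ∀ F : List (PlanarTree D), P F
  | [] => nil
  | t :: F => tree_induction_aux nil cons t F (forest_induction_aux nil cons F)
end

variable {K} in
/-- The algebra is the smallest subspace that contains `1` and is closed under
`(x, y) ↦ B_d^+(x) y`. -/
@[elab_as_elim]
lemma graft_induction {P : H K D → Prop} (zero : P 0)
    (add : ∀ x y, P x → P y → P (x + y)) (smul : ∀ (c : K) x, P x → P (c • x))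
    (one : P 1) (graft_mul : ∀ d x y, P x → P y → P (graft K d x * y)) (x : H K D) : P x := by
  have key : ∀ F : List (PlanarTree D), P (forest K F) :=
    forest_induction_aux one fun d G F hG hF => by
      have := graft_mul d _ _ hG hF
      rwa [graft, extend_forest, forest_mul] at this
  refine Submodule.span_induction (p := fun x _ => P x) ?_ zero (fun x y _ _ => add x y)
    (fun c x _ => smul c x) ((MonoidAlgebra.basis (FreeMonoid (PlanarTree D)) K).mem_span x)
  rintro _ ⟨w, rfl⟩
  simpa [forest] using key (FreeMonoid.toList w)

/-- The right product `x ≻ y = x y - x ≺ y` on the whole algebra, for which `1 ≻ y = y`. -/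
def succH : H K D →ₗ[K] H K D →ₗ[K] H K D := LinearMap.mul K (H K D) - precH K

lemma succH_apply (x y : H K D) : succH K x y = x * y - precH K x y := rfl

lemma precH_add_succH (x y : H K D) : precH K x y + succH K x y = x * y := by
  rw [succH_apply]; abel

@[simp] lemma precH_one (x : H K D) : precH K 1 x = 0 := by
  rw [← forest_nil, precH, extend_forest]; rfl

@[simp] lemma succH_one (x : H K D) : succH K 1 x = x := by
  simp [succH_apply]

@[simp] lemma counit_one : counit K (1 : H K D) = 1 := by simp [← forest_nil]

/-- The recursive definition of `≺`, with the forests replaced by arbitrary elements. -/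
lemma precH_graft_mul (d : D) (g f x : H K D) : precH K (graft K d g * f) x =
    graft K d g * precH K f x + graft K d (g * succH K f x) := by
  have : (LinearMap.mul K (H K D) ∘ₗ graft K d).compr₂ ((precH K).flip x) =
      ((LinearMap.mul K (H K D)).compl₁₂ (graft K d) ((precH K).flip x)) +
        (((LinearMap.mul K (H K D)).compl₁₂ LinearMap.id ((succH K).flip x)).compr₂
          (graft K d)) := by
    refine ext_forest K fun G => ext_forest K fun F => ?_
    simp [graft, forest_mul, precH, forestPrec, succH_apply]
  exact LinearMap.congr_fun (LinearMap.congr_fun this g) f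

lemma precH_graft (d : D) (g x : H K D) :
    precH K (graft K d g) x = graft K d (g * x) := by
  simpa using precH_graft_mul K d g 1 x

lemma precH_graft_mul' (d : D) (g f x : H K D) : precH K (graft K d g * f) x =
    graft K d g * precH K f x + precH K (graft K d g) (succH K f x) := by
  rw [precH_graft_mul, precH_graft]

/-- The sum of the first two dendriform axioms, `(x y) ≺ z = x (y ≺ z) + x ≺ (y ≻ z)`; the
recursive definition of `≺` is the case where `x` is a tree. -/
lemma precH_mul (x y z : H K D) :
    precH K (x * y) z = x * precH K y z + precH K x (succH K y z) := by
  induction x using graft_induction generalizing y z with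
  | zero => simp
  | add x x' hx hx' => simp only [add_mul, map_add, LinearMap.add_apply, hx, hx']; abel
  | smul c x hx => simp [hx]
  | one => simp
  | graft_mul d g f _ hf =>
    rw [mul_assoc, precH_graft_mul', hf, precH_graft_mul', succH_apply, succH_apply, hf,
      succH_apply, succH_apply]
    simp only [map_sub, map_add, mul_add, mul_assoc, mul_sub]
    abel

lemma precH_precH (x y z : H K D) : precH K (precH K x y) z = precH K x (y * z) := by
  induction x using graft_induction generalizing y z with
  | zero => simp
  | add x x' hx hx' => simp only [map_add, LinearMap.add_apply, hx, hx']
  | smul c x hx => simp [hx]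
  | one => simp
  | graft_mul d g f _ hf =>
    rw [precH_graft_mul, map_add, LinearMap.add_apply, precH_graft_mul, precH_graft, hf,
      precH_graft_mul, succH_apply, succH_apply, succH_apply, hf]
    simp only [map_sub, mul_assoc, mul_sub, sub_mul]
    abel

lemma succH_precH (x y z : H K D) : precH K (succH K x y) z = succH K x (precH K y z) := by
  rw [succH_apply, map_sub, LinearMap.sub_apply, precH_mul, precH_precH, succH_apply,
    succH_apply, map_sub]
  abel

lemma succH_mul (x y z : H K D) : succH K (x * y) z = succH K x (succH K y z) := by
  rw [succH_apply, precH_mul, succH_apply K x, succH_apply, mul_sub, mul_assoc]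
  abel

lemma isDendriformAlgebra : IsDendriformAlgebra (prec K D) (succ K D) where
  prec_prec a b c := by
    ext1
    change precH K (precH K a.1 b.1) c.1 =
      precH K a.1 (precH K b.1 c.1 + (b.1 * c.1 - precH K b.1 c.1))
    rw [precH_precH, add_sub_cancel]
  succ_prec a b c := Subtype.ext (succH_precH K a.1 b.1 c.1)
  mul_succ a b c := by
    ext1
    change succH K (precH K a.1 b.1 + succH K a.1 b.1) c.1 = succH K a.1 (succH K b.1 c.1)
    rw [precH_add_succH, succH_mul]

/-! ### The left and right coproducts of the whole algebra -/

/- The coproduct is split according to the last leaf of the forest, reached from the last root by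
going down through the last children: the left coproduct sums over the admissible cuts whose pruned
part contains this leaf. The last leaf of `t F` is the one of `F` when `F` is not empty, and the one
of `B_d^+(G)` is the one of `G` when `G` is not empty. -/

mutual
/-- The values of the left coproduct on trees: the total cut, and the contributing cuts of the
forest below the root. -/
def treeComulL : PlanarTree D → H K D ⊗[K] H K D
  | node d G => forest K [node d G] ⊗ₜ[K] 1 + (graft K d).lTensor (H K D) (forestComulL G)
/-- The values of the left coproduct on forests: all the cuts of the first trees are combined with
those of the last tree that contribute. -/
def forestComulL : List (PlanarTree D) → H K D ⊗[K] H K D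
  | [] => 0
  | t :: F => (if F.isEmpty then treeComulL t else 0) + comul K (forest K [t]) * forestComulL F
end

/-- The left coproduct on the whole algebra: the part of the coproduct given by the admissible cuts
that prune the last leaf. The total cut belongs to it, and the left coproduct of `1` is `0`. -/
def comulL : H K D →ₗ[K] H K D ⊗[K] H K D := extend K (forestComulL K)

/-- The right coproduct on the whole algebra: the part of the coproduct given by the admissible cuts
that keep the last leaf, together with `1 ↦ 1 ⊗ 1`. -/
def comulR : H K D →ₗ[K] H K D ⊗[K] H K D := comul K - comulL K

lemma comulL_add_comulR (x : H K D) : comulL K x + comulR K x = comul K x := by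
  simp [comulR]

lemma comulR_apply (x : H K D) : comulR K x = comul K x - comulL K x := rfl

@[simp] lemma comulL_one : comulL K (1 : H K D) = 0 := by
  rw [← forest_nil, comulL, extend_forest, forestComulL]

@[simp] lemma comulR_one : comulR K (1 : H K D) = 1 := by
  simp [comulR_apply, comul_one]

lemma comulL_graft (d : D) (x : H K D) : comulL K (graft K d x) =
    graft K d x ⊗ₜ[K] 1 + (graft K d).lTensor (H K D) (comulL K x) := by
  have : comulL K ∘ₗ graft K d = (TensorProduct.mk K (H K D) (H K D)).flip 1 ∘ₗ graft K d +
      (graft K d).lTensor (H K D) ∘ₗ comulL K := by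
    refine ext_forest K fun F => ?_
    simp [graft, comulL, forestComulL, treeComulL]
  exact LinearMap.congr_fun this x

lemma comulR_graft (d : D) (x : H K D) : comulR K (graft K d x) =
    (graft K d).lTensor (H K D) (comulR K x) := by
  rw [comulR_apply, comul_graft, comulL_graft, comulR_apply, map_sub]
  abel

/-- When `ε(y) = 0` this is `Δ_≺(x y) = Δ(x) Δ_≺(y)`; the other term accounts for the last leaf of
`x y` being the one of `x` when `y = 1`. -/
lemma comulL_mul (x y : H K D) :
    comulL K (x * y) = comul K x * comulL K y + counit K y • comulL K x := by
  have : (LinearMap.mul K (H K D)).compr₂ (comulL K) =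
      (LinearMap.mul K (H K D ⊗[K] H K D)).compl₁₂ (comul K) (comulL K) +
        (LinearMap.lsmul K (H K D ⊗[K] H K D)).flip.compl₁₂ (comulL K) (counit K) := by
    refine ext_forest K fun F => ext_forest K fun G => ?_
    simp only [LinearMap.compr₂_apply, LinearMap.mul_apply', LinearMap.compl₁₂_apply, forest_mul,
      LinearMap.add_apply, LinearMap.flip_apply, LinearMap.lsmul_apply]
    induction F with
    | nil => simp [forest_nil, comul_one]
    | cons t F ih =>
      have e : ∀ F : List (PlanarTree D), comulL K (forest K (t :: F)) =
          (if F.isEmpty then treeComulL K t else 0) +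
            comul K (forest K [t]) * comulL K (forest K F) := by
        intro F
        simp [comulL, forestComulL]
      rw [List.cons_append, e, ih, e, comul_forest_cons K t F, mul_assoc]
      cases F <;> cases G <;> simp [mul_add]
      all_goals abel
  exact LinearMap.congr_fun (LinearMap.congr_fun this x) y

lemma comulR_mul (x y : H K D) :
    comulR K (x * y) = comul K x * comulR K y +
      counit K y • (comulR K - comul K : H K D →ₗ[K] H K D ⊗[K] H K D) x := by
  rw [comulR_apply, comul_mul, comulL_mul, comulR_apply, LinearMap.sub_apply, comulR_apply,
    mul_sub]
  simp only [sub_sub_cancel_left, smul_neg]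
  abel

lemma rTensor_counit_comul (x : H K D) :
    (counit K).rTensor (H K D) (comul K x) = 1 ⊗ₜ[K] x := by
  induction x using graft_induction with
  | zero => simp
  | add x y hx hy => simp [hx, hy, TensorProduct.tmul_add]
  | smul c x hx => simp [hx]
  | one => simp [comul_one, Algebra.TensorProduct.one_def]
  | graft_mul d x y hx hy =>
    rw [comul_mul, rTensor_mul_of_map_mul (counit_mul K), hy, comul_graft, map_add,
      LinearMap.rTensor_tmul, counit_graft, TensorProduct.zero_tmul, zero_add,
      ← LinearMap.comp_apply, LinearMap.rTensor_comp_lTensor, ← LinearMap.lTensor_comp_rTensor,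
      LinearMap.comp_apply, hx]
    simp

lemma lTensor_counit_lTensor_graft (d : D) (X : H K D ⊗[K] H K D) :
    (counit K).lTensor (H K D) ((graft K d).lTensor (H K D) X) = 0 := by
  have : counit K ∘ₗ graft K d = 0 := LinearMap.ext (counit_graft K d)
  rw [← LinearMap.lTensor_comp_apply, this, LinearMap.lTensor_zero, LinearMap.zero_apply]

lemma lTensor_counit_comul (x : H K D) :
    (counit K).lTensor (H K D) (comul K x) = x ⊗ₜ[K] 1 := by
  induction x using graft_induction with
  | zero => simp
  | add x y hx hy => simp [hx, hy, TensorProduct.add_tmul]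
  | smul c x hx => simp [hx, TensorProduct.smul_tmul']
  | one => simp [comul_one, Algebra.TensorProduct.one_def]
  | graft_mul d x y hx hy =>
    rw [comul_mul, lTensor_mul_of_map_mul (counit_mul K), hy, comul_graft, map_add,
      lTensor_counit_lTensor_graft]
    simp

lemma rTensor_counit_comulL (x : H K D) :
    (counit K).rTensor (H K D) (comulL K x) = 0 := by
  induction x using graft_induction with
  | zero => simp
  | add x y hx hy => simp [hx, hy]
  | smul c x hx => simp [hx]
  | one => simp
  | graft_mul d x y hx hy =>
    rw [comulL_mul, map_add, rTensor_mul_of_map_mul (counit_mul K), hy, mul_zero, zero_add,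
      comulL_graft, map_smul, map_add,
      LinearMap.rTensor_tmul, counit_graft, TensorProduct.zero_tmul, zero_add,
      ← LinearMap.comp_apply, LinearMap.rTensor_comp_lTensor, ← LinearMap.lTensor_comp_rTensor,
      LinearMap.comp_apply, hx]
    simp

lemma lTensor_counit_comulL (x : H K D) :
    (counit K).lTensor (H K D) (comulL K x) = (x - counit K x • 1) ⊗ₜ[K] 1 := by
  induction x using graft_induction with
  | zero => simp
  | add x y hx hy => simp [hx, hy, ← TensorProduct.add_tmul, add_smul]; congr 1; abel
  | smul c x hx => simp [hx, TensorProduct.smul_tmul', smul_sub, mul_smul]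
  | one => simp
  | graft_mul d x y hx hy =>
    rw [comulL_mul, map_add, lTensor_mul_of_map_mul (counit_mul K), hy, map_smul, comulL_graft,
      comul_graft, map_add, map_add, lTensor_counit_lTensor_graft, lTensor_counit_lTensor_graft,
      counit_mul, counit_graft]
    simp [mul_sub, TensorProduct.smul_tmul', TensorProduct.sub_tmul]

lemma lTensor_counit_comulR (x : H K D) :
    (counit K).lTensor (H K D) (comulR K x) = counit K x • (1 ⊗ₜ[K] 1) := by
  rw [comulR_apply, map_sub, lTensor_counit_comul, lTensor_counit_comulL,
    ← TensorProduct.sub_tmul, sub_sub_cancel, TensorProduct.smul_tmul']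

lemma comul_coassoc (x : H K D) :
    TensorProduct.assoc K _ _ _ ((comul K).rTensor (H K D) (comul K x)) =
      (comul K).lTensor (H K D) (comul K x) := by
  induction x using graft_induction with
  | zero => simp
  | add x y hx hy => simp only [map_add, hx, hy]
  | smul c x hx => simp only [map_smul, hx]
  | one => simp [comul_one, Algebra.TensorProduct.one_def]
  | graft_mul d x y hx hy =>
    rw [comul_mul, rTensor_mul_of_map_mul (comul_mul K), lTensor_mul_of_map_mul (comul_mul K),
      assoc_mul, hy]
    congr 1
    conv_lhs =>
      rw [comul_graft, map_add, map_add, LinearMap.rTensor_tmul, comul_graft,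
        assoc_rTensor_lTensor, hx, assoc_tmul_one]
    conv_rhs =>
      rw [comul_graft, map_add, lTensor_lTensor_of_cocycle (comul_graft K d)]
    simp [comul_one, Algebra.TensorProduct.one_def, add_assoc]

lemma comulL_comulL_graft {d : D} {x : H K D}
    (hx : TensorProduct.assoc K _ _ _ ((comulL K).rTensor (H K D) (comulL K x)) =
      (comul K).lTensor (H K D) (comulL K x)) :
    TensorProduct.assoc K _ _ _ ((comulL K).rTensor (H K D) (comulL K (graft K d x))) =
      (comul K).lTensor (H K D) (comulL K (graft K d x)) := by
  conv_lhs =>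
    rw [comulL_graft, map_add, map_add, LinearMap.rTensor_tmul, comulL_graft,
      assoc_rTensor_lTensor, hx, assoc_tmul_one]
  conv_rhs =>
    rw [comulL_graft, map_add, lTensor_lTensor_of_cocycle (comul_graft K d)]
  simp [comul_one, Algebra.TensorProduct.one_def, add_assoc]

lemma comulL_comulL (x : H K D) :
    TensorProduct.assoc K _ _ _ ((comulL K).rTensor (H K D) (comulL K x)) =
      (comul K).lTensor (H K D) (comulL K x) := by
  induction x using graft_induction with
  | zero => simp
  | add x y hx hy => simp only [map_add, hx, hy]
  | smul c x hx => simp only [map_smul, hx]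
  | one => simp
  | graft_mul d x y hx hy =>
    rw [comulL_mul, map_add, map_add, map_add, rTensor_mul_of_mul (comulL_mul K),
      lTensor_mul_of_map_mul (comul_mul K), rTensor_counit_comulL, map_zero, mul_zero, add_zero,
      assoc_mul, hy, comul_coassoc, map_smul, map_smul, map_smul, comulL_comulL_graft K hx]

lemma comulR_comulL_graft {d : D} {x : H K D}
    (hx : TensorProduct.assoc K _ _ _ ((comulR K).rTensor (H K D) (comulL K x)) =
      (comulL K).lTensor (H K D) (comulR K x)) :
    TensorProduct.assoc K _ _ _ ((comulR K).rTensor (H K D) (comulL K (graft K d x))) =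
      (comulL K).lTensor (H K D) (comulR K (graft K d x)) := by
  rw [comulL_graft, map_add, map_add, LinearMap.rTensor_tmul, comulR_graft,
    assoc_rTensor_lTensor, hx, assoc_tmul_one, lTensor_lTensor_of_cocycle (comulL_graft K d)]

lemma comulR_comulL (x : H K D) :
    TensorProduct.assoc K _ _ _ ((comulR K).rTensor (H K D) (comulL K x)) =
      (comulL K).lTensor (H K D) (comulR K x) := by
  induction x using graft_induction with
  | zero => simp
  | add x y hx hy => simp only [map_add, hx, hy]
  | smul c x hx => simp only [map_smul, hx]
  | one => simp [Algebra.TensorProduct.one_def]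
  | graft_mul d x y hx hy =>
    rw [comulL_mul, comulR_mul, map_add, map_add, map_add, rTensor_mul_of_mul (comulR_mul K),
      lTensor_mul_of_mul (comulL_mul K), rTensor_counit_comulL, map_zero, mul_zero, add_zero,
      assoc_mul, hy, comul_coassoc, map_smul, map_smul, map_smul, comulR_comulL_graft K hx,
      lTensor_counit_comulR, LinearMap.sub_apply, map_sub]
    have e : (Algebra.linearMap K (H K D ⊗[K] H K D)).lTensor (H K D) (1 ⊗ₜ[K] 1) = 1 := by
      rw [LinearMap.lTensor_tmul, Algebra.linearMap_apply, map_one]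
      rfl
    rw [map_smul, e, mul_smul_comm, mul_one, smul_sub]
    abel

/-- This follows from the coassociativity of the coproduct and the other two identities. -/
lemma comul_comulR (x : H K D) :
    TensorProduct.assoc K _ _ _ ((comul K).rTensor (H K D) (comulR K x)) =
      (comulR K).lTensor (H K D) (comulR K x) := by
  have hs : comul K = comulL K + comulR K (D := D) :=
    LinearMap.ext fun x => (comulL_add_comulR K x).symm
  have hr : ∀ X : H K D ⊗[K] H K D, (comul K).rTensor (H K D) X =
      (comulL K).rTensor (H K D) X + (comulR K).rTensor (H K D) X := fun X => by
    rw [hs, LinearMap.rTensor_add, LinearMap.add_apply]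
  have hl : (comul K).lTensor (H K D) (comulR K x) = (comulL K).lTensor (H K D) (comulR K x) +
      (comulR K).lTensor (H K D) (comulR K x) := by
    rw [hs, LinearMap.lTensor_add, LinearMap.add_apply]
  have h1 := comul_coassoc K x
  rw [← comulL_add_comulR, map_add, map_add, map_add, hr (comulL K x), map_add, comulL_comulL,
    comulR_comulL, add_assoc] at h1
  exact add_left_cancel ((add_left_cancel h1).trans hl)

/-! ### The Hopf algebra of forests -/

/-- The coproduct preserves the number of vertices and `η ∘ ε - id` vanishes on `1`, so that each
convolution factor uses up at least one vertex. -/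
lemma convPow_forest_eq_zero (n : ℕ) : ∀ F : List (PlanarTree D), forestSize F < n →
    convPow (comul K) (counit K) n (forest K F) = 0 := by
  induction n with
  | zero => simp
  | succ n ih =>
    intro F hF
    rw [convPow, LinearMap.comp_apply, LinearMap.comp_apply, comul_forest, map_list_sum,
      map_list_sum]
    refine List.sum_eq_zero fun y hy => ?_
    simp only [List.map_map, List.mem_map, Function.comp_apply] at hy
    obtain ⟨C, hC, rfl⟩ := hy
    have hsize := forestSize_pruned_add_forestSize_remaining C
    rw [forestForget_of_mem_forestCuts F C hC] at hsize
    split_ifs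
    · by_cases hR : forestRemaining C = []
      · rw [TensorProduct.map_tmul, hR, forest_nil, LinearMap.sub_apply, LinearMap.comp_apply,
          counit_one, Algebra.linearMap_apply, _root_.map_one, LinearMap.id_apply, sub_self,
          TensorProduct.tmul_zero, map_zero]
      · have := forestSize_pos hR
        rw [TensorProduct.map_tmul, ih _ (by omega)]
        simp
    · simp

lemma isHopfAlgebra : IsHopfAlgebra (comul K : H K D →ₗ[K] H K D ⊗[K] H K D) (counit K) where
  coassoc := comul_coassoc K
  rTensor_counit := rTensor_counit_comul K
  lTensor_counit := lTensor_counit_comul K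
  comul_one := comul_one K
  comul_mul := comul_mul K
  counit_one := counit_one K
  counit_mul := counit_mul K
  antipode := by
    refine exists_antipode (comul_coassoc K) (rTensor_counit_comul K) (lTensor_counit_comul K)
      fun x => ?_
    induction (MonoidAlgebra.basis (FreeMonoid (PlanarTree D)) K).mem_span x using
      Submodule.span_induction with
    | mem x hx =>
      obtain ⟨w, rfl⟩ := hx
      refine ⟨forestSize (FreeMonoid.toList w) + 1, fun m hm => ?_⟩
      simpa [forest] using convPow_forest_eq_zero K m (FreeMonoid.toList w) hm
    | zero => exact ⟨0, by simp⟩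
    | add x y _ _ hx hy =>
      obtain ⟨a, ha⟩ := hx
      obtain ⟨b, hb⟩ := hy
      exact ⟨max a b, fun m hm => by
        rw [map_add, ha m (le_of_max_le_left hm), hb m (le_of_max_le_right hm), add_zero]⟩
    | smul c x _ hx =>
      obtain ⟨a, ha⟩ := hx
      exact ⟨a, fun m hm => by rw [map_smul, ha m hm, smul_zero]⟩

/-! ### Compatibility of the half coproducts with the half products -/

lemma map₂_tmul_one_mul (u : H K D) (Y Z : H K D ⊗[K] H K D) :
    TensorProduct.map₂ (LinearMap.mul K (H K D)) (precH K) ((u ⊗ₜ[K] 1) * Y) Z =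
      (u ⊗ₜ[K] 1) * TensorProduct.map₂ (LinearMap.mul K (H K D)) (precH K) Y Z := by
  induction Y with
  | zero => simp
  | add Y Y' hY hY' => simp only [mul_add, map_add, LinearMap.add_apply, hY, hY']
  | tmul y y' =>
    induction Z with
    | zero => simp
    | add Z Z' hZ hZ' => simp only [mul_add, map_add, hZ, hZ']
    | tmul z z' => simp [mul_assoc]

lemma map₂_succH (Y Z : H K D ⊗[K] H K D) :
    TensorProduct.map₂ (LinearMap.mul K (H K D)) (succH K) Y Z =
      Y * Z - TensorProduct.map₂ (LinearMap.mul K (H K D)) (precH K) Y Z := by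
  induction Y with
  | zero => simp
  | add Y Y' hY hY' => simp only [add_mul, map_add, LinearMap.add_apply, hY, hY']; abel
  | tmul y y' =>
    induction Z with
    | zero => simp
    | add Z Z' hZ hZ' => simp only [mul_add, map_add, hZ, hZ']; abel
    | tmul z z' => simp [succH_apply, TensorProduct.tmul_sub]

lemma map₂_lTensor_graft_mul (d : D) (X Y Z : H K D ⊗[K] H K D) :
    TensorProduct.map₂ (LinearMap.mul K (H K D)) (precH K)
        ((graft K d).lTensor (H K D) X * Y) Z =
      (graft K d).lTensor (H K D) X *
          TensorProduct.map₂ (LinearMap.mul K (H K D)) (precH K) Y Z +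
        (graft K d).lTensor (H K D)
          (X * TensorProduct.map₂ (LinearMap.mul K (H K D)) (succH K) Y Z) := by
  induction X with
  | zero => simp
  | add X X' hX hX' => simp only [add_mul, map_add, LinearMap.add_apply, hX, hX']; abel
  | tmul x x' =>
    induction Y with
    | zero => simp
    | add Y Y' hY hY' => simp only [mul_add, map_add, LinearMap.add_apply, hY, hY']; abel
    | tmul y y' =>
      induction Z with
      | zero => simp
      | add Z Z' hZ hZ' => simp only [mul_add, map_add, hZ, hZ']; abel
      | tmul z z' => simp [precH_graft_mul, TensorProduct.tmul_add, mul_assoc]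

lemma counit_succH (x y : H K D) : counit K (succH K x y) = counit K x * counit K y := by
  rw [succH_apply, map_sub, counit_mul, counit_precH, sub_zero]

lemma comulR_mul_of_counit_eq_zero (x : H K D) {y : H K D} (hy : counit K y = 0) :
    comulR K (x * y) = comul K x * comulR K y := by
  rw [comulR_mul, hy, zero_smul, add_zero]

lemma comulL_mul_of_counit_eq_zero (x : H K D) {y : H K D} (hy : counit K y = 0) :
    comulL K (x * y) = comul K x * comulL K y := by
  rw [comulL_mul, hy, zero_smul, add_zero]

/-- The compatibility `Δ_≻(a ≺ b) = Δ(a) ≺ Δ_≻(b)`, for the left product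
`(x ⊗ y) ≺ (z ⊗ w) = x z ⊗ (y ≺ w)` on `H ⊗ H`. -/
lemma comulR_precH (a : H K D) {b : H K D} (hb : counit K b = 0) :
    comulR K (precH K a b) =
      TensorProduct.map₂ (LinearMap.mul K (H K D)) (precH K) (comul K a) (comulR K b) := by
  induction a using graft_induction with
  | zero => simp
  | add x y hx hy => simp only [map_add, LinearMap.add_apply, hx, hy]
  | smul c x hx => simp only [map_smul, LinearMap.smul_apply, hx]
  | one =>
    rw [precH_one, map_zero, comul_one, Algebra.TensorProduct.one_def]
    induction comulR K b with
    | zero => simp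
    | add Z Z' hZ hZ' => rw [map_add, ← hZ, ← hZ', add_zero]
    | tmul z z' => simp
  | graft_mul d g f _ hf =>
    have hs : counit K (succH K f b) = 0 := by rw [counit_succH, hb, mul_zero]
    have e : comulR K (succH K f b) = TensorProduct.map₂ (LinearMap.mul K (H K D)) (succH K)
        (comul K f) (comulR K b) := by
      rw [map₂_succH, succH_apply, map_sub, comulR_mul_of_counit_eq_zero K f hb, hf]
    rw [precH_graft_mul, map_add, comulR_mul_of_counit_eq_zero K _ (counit_precH K f b), hf,
      comulR_graft, comulR_mul_of_counit_eq_zero K _ hs, e, comul_mul, comul_graft, add_mul,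
      add_mul, map_add, LinearMap.add_apply, map₂_tmul_one_mul, map₂_lTensor_graft_mul, add_assoc]

lemma comulR_succH (a : H K D) {b : H K D} (hb : counit K b = 0) :
    comulR K (succH K a b) =
      TensorProduct.map₂ (LinearMap.mul K (H K D)) (succH K) (comul K a) (comulR K b) := by
  rw [map₂_succH, succH_apply, map_sub, comulR_mul_of_counit_eq_zero K a hb, comulR_precH K a hb]

lemma lTensor_graft_mul_tmul_one (d : D) (X : H K D ⊗[K] H K D) (u : H K D) :
    (graft K d).lTensor (H K D) (X * (u ⊗ₜ[K] 1)) =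
      (graft K d).lTensor (H K D) X * (u ⊗ₜ[K] 1) := by
  induction X with
  | zero => simp
  | add X X' hX hX' => simp only [add_mul, map_add, hX, hX']
  | tmul x x' => simp

/-- The compatibility `Δ_≺(a ≺ b) = Δ(a) ≺ Δ_≺(b) + (a ≺ b) ⊗ 1`. The last term corrects the
convention `1 ≺ 1 = 0`: the product of `a ⊗ 1` and `b ⊗ 1` should contribute `(a ≺ b) ⊗ 1` here, and
`(a ≻ b) ⊗ 1` to `Δ_≺(a ≻ b)`. -/
lemma comulL_precH (a : H K D) {b : H K D} (hb : counit K b = 0) :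
    comulL K (precH K a b) =
      TensorProduct.map₂ (LinearMap.mul K (H K D)) (precH K) (comul K a) (comulL K b) +
        precH K a b ⊗ₜ[K] 1 := by
  induction a using graft_induction with
  | zero => simp
  | add x y hx hy => simp only [map_add, LinearMap.add_apply, hx, hy, TensorProduct.add_tmul]; abel
  | smul c x hx =>
    simp only [map_smul, LinearMap.smul_apply, hx, smul_add, TensorProduct.smul_tmul']
  | one =>
    rw [precH_one, map_zero, comul_one, Algebra.TensorProduct.one_def, TensorProduct.zero_tmul,
      add_zero]
    induction comulL K b with
    | zero => simp
    | add Z Z' hZ hZ' => rw [map_add, ← hZ, ← hZ', add_zero]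
    | tmul z z' => simp
  | graft_mul d g f _ hf =>
    have hs : counit K (succH K f b) = 0 := by rw [counit_succH, hb, mul_zero]
    have e : comulL K (succH K f b) = TensorProduct.map₂ (LinearMap.mul K (H K D)) (succH K)
        (comul K f) (comulL K b) - precH K f b ⊗ₜ[K] 1 := by
      rw [map₂_succH, succH_apply, map_sub, comulL_mul_of_counit_eq_zero K f hb, hf]
      abel
    rw [precH_graft_mul, map_add, comulL_mul_of_counit_eq_zero K _ (counit_precH K f b), hf,
      comulL_graft, comulL_mul_of_counit_eq_zero K _ hs, e, comul_mul, comul_graft, add_mul,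
      add_mul, map_add, LinearMap.add_apply, map₂_tmul_one_mul, map₂_lTensor_graft_mul,
      mul_sub, map_sub, lTensor_graft_mul_tmul_one, TensorProduct.add_tmul, mul_add, mul_add]
    have e' : (graft K d g * precH K f b) ⊗ₜ[K] (1 : H K D) =
        (graft K d g ⊗ₜ[K] 1) * (precH K f b ⊗ₜ[K] 1) := by simp
    rw [e']
    abel

lemma comulL_succH (a : H K D) {b : H K D} (hb : counit K b = 0) :
    comulL K (succH K a b) =
      TensorProduct.map₂ (LinearMap.mul K (H K D)) (succH K) (comul K a) (comulL K b) -
        precH K a b ⊗ₜ[K] 1 := by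
  rw [map₂_succH, succH_apply, map_sub, comulL_mul_of_counit_eq_zero K a hb, comulL_precH K a hb]
  abel

lemma precH_one_right (x : H K D) : precH K x 1 = x - counit K x • 1 := by
  induction x using graft_induction with
  | zero => simp
  | add x y hx hy => simp only [map_add, LinearMap.add_apply, hx, hy, add_smul]; abel
  | smul c x hx => simp only [map_smul, LinearMap.smul_apply, hx, smul_sub, smul_eq_mul, mul_smul]
  | one => simp
  | graft_mul d x y _ hy =>
    rw [precH_graft_mul, succH_apply, hy, counit_mul, counit_graft]
    simp [mul_sub]

/-! ### The bidendriform structure of the augmentation ideal -/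

@[simp] lemma augProj_one : augProj K D 1 = 0 := by
  ext1
  rw [augProj_coe, counit_one, one_smul, sub_self]
  rfl

@[simp] lemma augProj_coe_eq (a : augIdeal K D) : augProj K D a.1 = a := by
  ext1
  rw [augProj_coe, LinearMap.mem_ker.mp a.2, zero_smul, sub_zero]

/-- The map induced on the augmentation ideal by a map `H → H ⊗ H`, by projection of both factors
along the unit. -/
def reduce (δ : H K D →ₗ[K] H K D ⊗[K] H K D) :
    augIdeal K D →ₗ[K] augIdeal K D ⊗[K] augIdeal K D :=
  TensorProduct.map (augProj K D) (augProj K D) ∘ₗ δ ∘ₗ (augIdeal K D).subtype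

/-- The left coproduct of the augmentation ideal. -/
def redComulL : augIdeal K D →ₗ[K] augIdeal K D ⊗[K] augIdeal K D := reduce K (comulL K)

/-- The right coproduct of the augmentation ideal. -/
def redComulR : augIdeal K D →ₗ[K] augIdeal K D ⊗[K] augIdeal K D := reduce K (comulR K)

lemma redComulL_add_redComulR : redComulL K + redComulR K = redComul K D := by
  refine LinearMap.ext fun a => ?_
  change TensorProduct.map _ _ (comulL K a.1) + TensorProduct.map _ _ (comulR K a.1) =
    TensorProduct.map _ _ (comul K a.1)
  rw [← map_add, comulL_add_comulR]

lemma reduce_augProj {δ : H K D →ₗ[K] H K D ⊗[K] H K D}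
    (hδ : TensorProduct.map (augProj K D) (augProj K D) (δ 1) = 0) (x : H K D) :
    reduce K δ (augProj K D x) = TensorProduct.map (augProj K D) (augProj K D) (δ x) := by
  simp only [reduce, LinearMap.comp_apply, Submodule.subtype_apply, augProj_coe, map_sub, map_smul,
    hδ, smul_zero]
  exact sub_zero (TensorProduct.map (augProj K D) (augProj K D) (δ x))

/-- An iterated coproduct of the augmentation ideal is the projection of the iterated coproduct of
the whole algebra, because the projection onto the ideal kills the value of `δ` at `1`. -/
lemma assoc_rTensor_reduce {δ : H K D →ₗ[K] H K D ⊗[K] H K D}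
    (hδ : TensorProduct.map (augProj K D) (augProj K D) (δ 1) = 0) (X : H K D ⊗[K] H K D) :
    TensorProduct.assoc K _ _ _ ((reduce K δ).rTensor (augIdeal K D)
        (TensorProduct.map (augProj K D) (augProj K D) X)) =
      TensorProduct.map (augProj K D) (TensorProduct.map (augProj K D) (augProj K D))
        (TensorProduct.assoc K _ _ _ (δ.rTensor (H K D) X)) := by
  induction X with
  | zero => simp
  | add X Y hX hY => simp only [map_add, hX, hY]
  | tmul x y =>
    rw [TensorProduct.map_tmul, LinearMap.rTensor_tmul, LinearMap.rTensor_tmul,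
      reduce_augProj K hδ]
    induction δ x with
    | zero => simp
    | add X Y hX hY => simp only [TensorProduct.add_tmul, map_add, hX, hY]
    | tmul z w => simp

lemma lTensor_reduce {δ : H K D →ₗ[K] H K D ⊗[K] H K D}
    (hδ : TensorProduct.map (augProj K D) (augProj K D) (δ 1) = 0) (X : H K D ⊗[K] H K D) :
    (reduce K δ).lTensor (augIdeal K D) (TensorProduct.map (augProj K D) (augProj K D) X) =
      TensorProduct.map (augProj K D) (TensorProduct.map (augProj K D) (augProj K D))
        (δ.lTensor (H K D) X) := by
  induction X with
  | zero => simp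
  | add X Y hX hY => simp only [map_add, hX, hY]
  | tmul x y =>
    rw [TensorProduct.map_tmul, LinearMap.lTensor_tmul, LinearMap.lTensor_tmul,
      reduce_augProj K hδ, TensorProduct.map_tmul]

lemma map_augProj_comulL_one :
    TensorProduct.map (augProj K D) (augProj K D) (comulL K 1) = 0 := by
  rw [comulL_one, map_zero]

lemma map_augProj_comulR_one :
    TensorProduct.map (augProj K D) (augProj K D) (comulR K 1) = 0 := by
  rw [comulR_one, Algebra.TensorProduct.one_def, TensorProduct.map_tmul, augProj_one,
    TensorProduct.zero_tmul]

lemma map_augProj_comul_one :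
    TensorProduct.map (augProj K D) (augProj K D) (comul K 1) = 0 := by
  rw [comul_one, Algebra.TensorProduct.one_def, TensorProduct.map_tmul, augProj_one,
    TensorProduct.zero_tmul]

lemma isDendriformCoalgebra :
    IsDendriformCoalgebra (redComulL K (D := D)) (redComulR K (D := D)) where
  left_left a := by
    rw [← LinearMap.lTensor_add, redComulL_add_redComulR]
    change TensorProduct.assoc K _ _ _ ((reduce K (comulL K)).rTensor _
      (TensorProduct.map _ _ (comulL K a.1))) =
      (reduce K (comul K)).lTensor _ (TensorProduct.map _ _ (comulL K a.1))
    rw [assoc_rTensor_reduce K (map_augProj_comulL_one K),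
      lTensor_reduce K (map_augProj_comul_one K), comulL_comulL]
  right_left a := by
    change TensorProduct.assoc K _ _ _ ((reduce K (comulR K)).rTensor _
      (TensorProduct.map _ _ (comulL K a.1))) =
      (reduce K (comulL K)).lTensor _ (TensorProduct.map _ _ (comulR K a.1))
    rw [assoc_rTensor_reduce K (map_augProj_comulR_one K),
      lTensor_reduce K (map_augProj_comulL_one K), comulR_comulL]
  sum_right a := by
    rw [← LinearMap.rTensor_add, redComulL_add_redComulR]
    change TensorProduct.assoc K _ _ _ ((reduce K (comul K)).rTensor _
      (TensorProduct.map _ _ (comulR K a.1))) =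
      (reduce K (comulR K)).lTensor _ (TensorProduct.map _ _ (comulR K a.1))
    rw [assoc_rTensor_reduce K (map_augProj_comul_one K),
      lTensor_reduce K (map_augProj_comulR_one K), comul_comulR]

/-- The inclusion `A ⊗ A → H ⊗ H`. -/
abbrev incl₂ (K : Type u) [Field K] (D : Type v) :
    augIdeal K D ⊗[K] augIdeal K D →ₗ[K] H K D ⊗[K] H K D :=
  TensorProduct.map (augIdeal K D).subtype (augIdeal K D).subtype

lemma incl₂_map_augProj (X : H K D ⊗[K] H K D) :
    incl₂ K D (TensorProduct.map (augProj K D) (augProj K D) X) =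
      X - (LinearMap.toSpanSingleton K (H K D) 1).lTensor _ ((counit K).lTensor _ X) -
        (LinearMap.toSpanSingleton K (H K D) 1).rTensor _ ((counit K).rTensor _
          (X - (LinearMap.toSpanSingleton K (H K D) 1).lTensor _ ((counit K).lTensor _ X))) := by
  induction X with
  | zero => simp
  | add X Y hX hY => simp only [map_add, map_sub, hX, hY]; abel
  | tmul x y =>
    simp only [incl₂, TensorProduct.map_tmul, Submodule.subtype_apply, augProj_coe,
      LinearMap.lTensor_tmul, LinearMap.rTensor_tmul, LinearMap.toSpanSingleton_apply,
      TensorProduct.sub_tmul, TensorProduct.tmul_sub, map_sub]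
    abel

lemma comulL_eq (b : augIdeal K D) :
    comulL K b.1 = b.1 ⊗ₜ[K] 1 + incl₂ K D (redComulL K b) := by
  have hb := LinearMap.mem_ker.mp b.2
  change _ = _ + incl₂ K D (TensorProduct.map _ _ (comulL K b.1))
  rw [incl₂_map_augProj, map_sub, rTensor_counit_comulL, lTensor_counit_comulL, hb]
  simp [hb]

lemma comulR_eq (b : augIdeal K D) :
    comulR K b.1 = 1 ⊗ₜ[K] b.1 + incl₂ K D (redComulR K b) := by
  have hb := LinearMap.mem_ker.mp b.2
  change _ = _ + incl₂ K D (TensorProduct.map _ _ (comulR K b.1))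
  rw [incl₂_map_augProj, map_sub, lTensor_counit_comulR, hb, zero_smul, map_zero, sub_zero,
    map_zero, sub_zero, comulR_apply, map_sub, rTensor_counit_comulL, rTensor_counit_comul]
  simp

lemma comul_eq (a : augIdeal K D) : comul K a.1 =
    a.1 ⊗ₜ[K] 1 + 1 ⊗ₜ[K] a.1 + incl₂ K D (redComul K D a) := by
  rw [← comulL_add_comulR, comulL_eq, comulR_eq, ← redComulL_add_redComulR, LinearMap.add_apply,
    map_add]
  abel

section Compatibility

variable {p : H K D →ₗ[K] H K D →ₗ[K] H K D}
  {q : augIdeal K D →ₗ[K] augIdeal K D →ₗ[K] augIdeal K D} {r s : augIdeal K D →ₗ[K] augIdeal K D}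

lemma prec_add_succ_coe (a b : augIdeal K D) : ((prec K D + succ K D) a b).1 = a.1 * b.1 := by
  change precH K a.1 b.1 + (a.1 * b.1 - precH K a.1 b.1) = _
  abel

lemma augProj_mul (a b : augIdeal K D) :
    augProj K D (a.1 * b.1) = (prec K D + succ K D) a b := by
  rw [← prec_add_succ_coe, augProj_coe_eq]

lemma map_augProj_map₂_incl₂ (hq : ∀ a b : augIdeal K D, augProj K D (p a.1 b.1) = q a b)
    (X Y : augIdeal K D ⊗[K] augIdeal K D) :
    TensorProduct.map (augProj K D) (augProj K D)
      (TensorProduct.map₂ (LinearMap.mul K (H K D)) p (incl₂ K D X) (incl₂ K D Y)) =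
    TensorProduct.map₂ (prec K D + succ K D) q X Y := by
  induction X with
  | zero => simp
  | add X X' hX hX' => simp only [map_add, LinearMap.add_apply, hX, hX']
  | tmul x x' =>
    induction Y with
    | zero => simp
    | add Y Y' hY hY' => simp only [map_add, hY, hY']
    | tmul y y' =>
      simp only [incl₂, TensorProduct.map_tmul, TensorProduct.map₂_apply_tmul,
        Submodule.subtype_apply, LinearMap.mul_apply', hq, augProj_mul]

lemma map_augProj_map₂_incl₂_tmul_right (u v : H K D) {f g : augIdeal K D →ₗ[K] augIdeal K D}
    (hf : ∀ x : augIdeal K D, augProj K D (x.1 * u) = f x)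
    (hg : ∀ x : augIdeal K D, augProj K D (p x.1 v) = g x)
    (X : augIdeal K D ⊗[K] augIdeal K D) :
    TensorProduct.map (augProj K D) (augProj K D)
      (TensorProduct.map₂ (LinearMap.mul K (H K D)) p (incl₂ K D X) (u ⊗ₜ[K] v)) =
    TensorProduct.map f g X := by
  induction X with
  | zero => simp
  | add X X' hX hX' => simp only [map_add, LinearMap.add_apply, hX, hX']
  | tmul x x' =>
    simp only [incl₂, TensorProduct.map_tmul, TensorProduct.map₂_apply_tmul,
      Submodule.subtype_apply, LinearMap.mul_apply', hf, hg]

lemma map_augProj_map₂_tmul_incl₂ (u v : H K D) {f g : augIdeal K D →ₗ[K] augIdeal K D}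
    (hf : ∀ x : augIdeal K D, augProj K D (u * x.1) = f x)
    (hg : ∀ x : augIdeal K D, augProj K D (p v x.1) = g x)
    (Y : augIdeal K D ⊗[K] augIdeal K D) :
    TensorProduct.map (augProj K D) (augProj K D)
      (TensorProduct.map₂ (LinearMap.mul K (H K D)) p (u ⊗ₜ[K] v) (incl₂ K D Y)) =
    TensorProduct.map f g Y := by
  induction Y with
  | zero => simp
  | add X X' hX hX' => simp only [map_add, hX, hX']
  | tmul x x' =>
    simp only [incl₂, TensorProduct.map_tmul, TensorProduct.map₂_apply_tmul,
      Submodule.subtype_apply, LinearMap.mul_apply', hf, hg]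

/-- The expansion on the augmentation ideal of a half product `Δ(a) * Δ_≻(b)` in `H ⊗ H`, with
`Δ(a) = a ⊗ 1 + 1 ⊗ a + Δ̃(a)` and `Δ_≻(b) = 1 ⊗ b + ⋯`. Here `p` is a half product on the whole
algebra, `q` its restriction to the ideal and `s` the left action of `1`. -/
lemma map_augProj_map₂_comulR (hq : ∀ a b : augIdeal K D, augProj K D (p a.1 b.1) = q a b)
    (hs : ∀ b : augIdeal K D, augProj K D (p 1 b.1) = s b) (a b : augIdeal K D) :
    TensorProduct.map (augProj K D) (augProj K D)
      (TensorProduct.map₂ (LinearMap.mul K (H K D)) p (comul K a.1) (comulR K b.1)) =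
    TensorProduct.map₂ (prec K D + succ K D) q (redComul K D a) (redComulR K b) +
      (q.flip b).lTensor _ (redComul K D a) + (q a).lTensor _ (redComulR K b) +
      TensorProduct.map ((prec K D + succ K D) a) s (redComulR K b) + a ⊗ₜ[K] s b := by
  rw [comul_eq, comulR_eq]
  simp only [map_add, LinearMap.add_apply]
  rw [map_augProj_map₂_incl₂ K hq,
    map_augProj_map₂_incl₂_tmul_right K 1 b.1 (f := LinearMap.id) (g := q.flip b) (by simp)
      (fun x => hq x b),
    map_augProj_map₂_tmul_incl₂ K 1 a.1 (f := LinearMap.id) (g := q a) (by simp)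
      (fun x => hq a x),
    map_augProj_map₂_tmul_incl₂ K a.1 1 (f := (prec K D + succ K D) a) (g := s)
      (fun x => augProj_mul K a x) hs]
  simp only [TensorProduct.map₂_apply_tmul, TensorProduct.map_tmul, LinearMap.mul_apply', mul_one,
    augProj_one, augProj_coe_eq, hs, TensorProduct.zero_tmul, add_zero, LinearMap.lTensor,
    LinearMap.add_apply]
  abel

/-- The analogous expansion of a half product `Δ(a) * Δ_≺(b)`, with `Δ_≺(b) = b ⊗ 1 + ⋯`; here `r`
is the right action of `1`. -/
lemma map_augProj_map₂_comulL (hq : ∀ a b : augIdeal K D, augProj K D (p a.1 b.1) = q a b)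
    (hs : ∀ b : augIdeal K D, augProj K D (p 1 b.1) = s b)
    (hr : ∀ a : augIdeal K D, augProj K D (p a.1 1) = r a)
    (h1 : augProj K D (p 1 1) = 0) (a b : augIdeal K D) :
    TensorProduct.map (augProj K D) (augProj K D)
      (TensorProduct.map₂ (LinearMap.mul K (H K D)) p (comul K a.1) (comulL K b.1)) =
    TensorProduct.map₂ (prec K D + succ K D) q (redComul K D a) (redComulL K b) +
      TensorProduct.map ((prec K D + succ K D).flip b) r (redComul K D a) +
      (q a).lTensor _ (redComulL K b) +
      TensorProduct.map ((prec K D + succ K D) a) s (redComulL K b) + b ⊗ₜ[K] r a := by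
  rw [comul_eq, comulL_eq]
  simp only [map_add, LinearMap.add_apply]
  rw [map_augProj_map₂_incl₂ K hq,
    map_augProj_map₂_incl₂_tmul_right K b.1 1 (f := (prec K D + succ K D).flip b) (g := r)
      (fun x => augProj_mul K x b) hr,
    map_augProj_map₂_tmul_incl₂ K 1 a.1 (f := LinearMap.id) (g := q a) (by simp)
      (fun x => hq a x),
    map_augProj_map₂_tmul_incl₂ K a.1 1 (f := (prec K D + succ K D) a) (g := s)
      (fun x => augProj_mul K a x) hs]
  simp only [TensorProduct.map₂_apply_tmul, TensorProduct.map_tmul, LinearMap.mul_apply', one_mul,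
    augProj_coe_eq, hr, h1, TensorProduct.tmul_zero, zero_add, LinearMap.lTensor,
    LinearMap.add_apply]
  abel

end Compatibility

lemma augProj_precH (a b : augIdeal K D) : augProj K D (precH K a.1 b.1) = prec K D a b :=
  augProj_coe_eq K (prec K D a b)

lemma augProj_succH (a b : augIdeal K D) : augProj K D (succH K a.1 b.1) = succ K D a b :=
  augProj_coe_eq K (succ K D a b)

lemma precH_coe_one (a : augIdeal K D) : precH K a.1 1 = a.1 := by
  rw [precH_one_right, LinearMap.mem_ker.mp a.2, zero_smul, sub_zero]

lemma succH_coe_one (a : augIdeal K D) : succH K a.1 1 = 0 := by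
  rw [succH_apply, precH_coe_one, mul_one, sub_self]

theorem isBidendriformBialgebra :
    IsBidendriformBialgebra (prec K D) (succ K D) (redComulL K) (redComulR K) where
  dendriformAlgebra := isDendriformAlgebra K
  dendriformCoalgebra := isDendriformCoalgebra K
  right_succ a b := by
    rw [redComulL_add_redComulR]
    change TensorProduct.map _ _ (comulR K (succH K a.1 b.1)) = _
    rw [comulR_succH K _ (LinearMap.mem_ker.mp b.2),
      map_augProj_map₂_comulR K (s := LinearMap.id) (augProj_succH K) (by simp)]
    rfl
  right_prec a b := by
    rw [redComulL_add_redComulR]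
    change TensorProduct.map _ _ (comulR K (precH K a.1 b.1)) = _
    rw [comulR_precH K _ (LinearMap.mem_ker.mp b.2),
      map_augProj_map₂_comulR K (s := 0) (augProj_precH K) (by simp)]
    simp
  left_succ a b := by
    rw [redComulL_add_redComulR]
    change TensorProduct.map _ _ (comulL K (succH K a.1 b.1)) = _
    rw [comulL_succH K _ (LinearMap.mem_ker.mp b.2), map_sub,
      map_augProj_map₂_comulL K (s := LinearMap.id) (r := 0) (augProj_succH K) (by simp)
        (fun x => by simp [succH_coe_one]) (by simp)]
    simp [LinearMap.rTensor]
    abel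
  left_prec a b := by
    rw [redComulL_add_redComulR]
    change TensorProduct.map _ _ (comulL K (precH K a.1 b.1)) = _
    rw [comulL_precH K _ (LinearMap.mem_ker.mp b.2), map_add,
      map_augProj_map₂_comulL K (s := 0) (r := LinearMap.id) (augProj_precH K) (by simp)
        (fun x => by simp [precH_coe_one]) (by simp)]
    simp [LinearMap.rTensor]

/-! ### Generation by the vertices and uniqueness -/

lemma coe_dot (d : D) : (dot K d).1 = graft K d 1 := by
  rw [← forest_nil, graft, extend_forest]
  rfl

lemma redComulL_dot (d : D) : redComulL K (dot K d) = 0 := by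
  change TensorProduct.map _ _ (comulL K (dot K d).1) = 0
  rw [coe_dot, comulL_graft, comulL_one]
  simp

lemma redComulR_dot (d : D) : redComulR K (dot K d) = 0 := by
  change TensorProduct.map _ _ (comulR K (dot K d).1) = 0
  rw [coe_dot, comulR_graft, comulR_one]
  simp [Algebra.TensorProduct.one_def]

/-- The single vertices generate the augmentation ideal as a dendriform algebra. -/
theorem dendriform_induction (S : Submodule K (augIdeal K D)) (dot_mem : ∀ d, dot K d ∈ S)
    (prec_mem : ∀ a b, a ∈ S → b ∈ S → prec K D a b ∈ S)
    (succ_mem : ∀ a b, a ∈ S → b ∈ S → succ K D a b ∈ S) : S = ⊤ := by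
  have mul_mem : ∀ a b : augIdeal K D, a ∈ S → b ∈ S → augProj K D (a.1 * b.1) ∈ S := by
    intro a b ha hb
    rw [augProj_mul]
    exact S.add_mem (prec_mem a b ha hb) (succ_mem a b ha hb)
  have key : ∀ x : H K D, augProj K D x ∈ S := by
    intro x
    induction x using graft_induction with
    | zero => simp
    | add x y hx hy => rw [map_add]; exact S.add_mem hx hy
    | smul c x hx => rw [map_smul]; exact S.smul_mem c hx
    | one => simp
    | graft_mul d x y hx hy =>
      -- `B_d(x) = d ≺ (x - ε(x)) + ε(x) d`
      have hg : augProj K D (graft K d x) ∈ S := by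
        have e : augProj K D (graft K d x) =
            prec K D (dot K d) (augProj K D x) + counit K x • dot K d := by
          ext1
          change _ = precH K (dot K d).1 (augProj K D x).1 + counit K x • (dot K d).1
          rw [augProj_coe, augProj_coe, counit_graft, coe_dot, precH_graft, one_mul, map_sub,
            map_smul, zero_smul, sub_zero, sub_add_cancel]
        rw [e]
        exact S.add_mem (prec_mem _ _ (dot_mem d) hx) (S.smul_mem _ (dot_mem d))
      have e : augProj K D (graft K d x * y) =
          augProj K D ((augProj K D (graft K d x)).1 * (augProj K D y).1) +
            counit K y • augProj K D (graft K d x) := by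
        rw [← map_smul, ← map_add, augProj_coe, augProj_coe, counit_graft, zero_smul, sub_zero,
          mul_sub, mul_smul_comm, mul_one, sub_add_cancel]
      rw [e]
      exact S.add_mem (mul_mem _ _ hg hy) (S.smul_mem _ hg)
  exact eq_top_iff.mpr fun a _ => augProj_coe_eq K a ▸ key a.1

/-- The compatibilities express the values of both coproducts at `a ≺ b` and `a ≻ b` through their
values at `a` and `b`, so a bidendriform structure is determined by its values on the vertices. -/
theorem comul_unique {dL dR dL' dR' : augIdeal K D →ₗ[K] augIdeal K D ⊗[K] augIdeal K D}
    (h : IsBidendriformBialgebra (prec K D) (succ K D) dL dR)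
    (h' : IsBidendriformBialgebra (prec K D) (succ K D) dL' dR')
    (hdot : ∀ d, dL (dot K d) = dL' (dot K d) ∧ dR (dot K d) = dR' (dot K d)) :
    dL = dL' ∧ dR = dR' := by
  have key : LinearMap.eqLocus dL dL' ⊓ LinearMap.eqLocus dR dR' = ⊤ := by
    refine dendriform_induction K _ hdot ?_ ?_ <;>
    · rintro a b ⟨haL, haR⟩ ⟨hbL, hbR⟩
      simp only [SetLike.mem_coe, LinearMap.mem_eqLocus] at haL haR hbL hbR
      refine ⟨?_, ?_⟩ <;> simp only [SetLike.mem_coe, LinearMap.mem_eqLocus] <;>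
      simp only [h.left_prec, h'.left_prec, h.right_prec, h'.right_prec, h.left_succ,
        h'.left_succ, h.right_succ, h'.right_succ, LinearMap.add_apply, haL, haR, hbL, hbR]
  have mem : ∀ a, a ∈ LinearMap.eqLocus dL dL' ⊓ LinearMap.eqLocus dR dR' := fun a => by
    rw [key]
    exact Submodule.mem_top
  exact ⟨LinearMap.ext fun a => (mem a).1, LinearMap.ext fun a => (mem a).2⟩

/-! ### Comparison with the Hopf algebra of forests -/

lemma fromUnit_apply (x : augIdeal K D × K) : fromUnit K D x = x.1.1 + x.2 • 1 := by
  simp [fromUnit]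

lemma fromUnit_bijective : Function.Bijective (fromUnit K D) := by
  have hc : ∀ x, counit K (fromUnit K D x) = x.2 := fun x => by
    rw [fromUnit_apply, map_add, LinearMap.mem_ker.mp x.1.2, map_smul, counit_one]
    simp
  refine ⟨fun x y hxy => ?_, fun x => ⟨(augProj K D x, counit K x), ?_⟩⟩
  · have h2 : x.2 = y.2 := by rw [← hc x, hxy, hc]
    rw [fromUnit_apply, fromUnit_apply, h2] at hxy
    exact Prod.ext (Subtype.ext (add_right_cancel hxy)) h2
  · rw [fromUnit_apply, augProj_coe, sub_add_cancel]

theorem inducesHopfStructure :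
    InducesHopfStructure K D (prec K D) (succ K D) (redComulL K) (redComulR K) where
  isHopfAlgebra := isHopfAlgebra K
  bijective := fromUnit_bijective K
  map_mul x y := by
    rw [fromUnit_apply, fromUnit_apply, fromUnit_apply]
    change ((prec K D + succ K D) x.1 y.1).1 + x.2 • y.1.1 + y.2 • x.1.1 + (x.2 * y.2) • 1 = _
    rw [prec_add_succ_coe]
    simp only [add_mul, mul_add, smul_mul_assoc, mul_smul_comm, one_mul, mul_one, mul_smul,
      smul_add]
    rw [smul_comm]
    abel
  map_one := by simp [fromUnit_apply]
  map_comul x := by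
    have hι : fromUnit K D ∘ₗ LinearMap.inl K (augIdeal K D) K = (augIdeal K D).subtype :=
      LinearMap.coprod_inl _ _
    rw [redComulL_add_redComulR, fromUnit_apply, map_add, comul_eq, map_smul, comul_one]
    simp only [unitComul, LinearMap.coprod_apply, LinearMap.add_apply, LinearMap.comp_apply,
      map_add, TensorProduct.mk_apply, LinearMap.flip_apply, TensorProduct.map_tmul,
      LinearMap.toSpanSingleton_apply, map_smul]
    rw [← LinearMap.comp_apply (TensorProduct.map _ _) (TensorProduct.map _ _),
      ← TensorProduct.map_comp, hι]
    simp [fromUnit_apply, Algebra.TensorProduct.one_def]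
    abel
  map_counit x := by
    rw [fromUnit_apply, map_add, LinearMap.mem_ker.mp x.1.2, map_smul, counit_one]
    simp

end CK

end

theorem mainTheorem5 (K : Type u) [Field K] (D : Type v) :
    (∃! Δ : (CK.augIdeal K D →ₗ[K] CK.augIdeal K D ⊗[K] CK.augIdeal K D) ×
        (CK.augIdeal K D →ₗ[K] CK.augIdeal K D ⊗[K] CK.augIdeal K D),
      IsBidendriformBialgebra (CK.prec K D) (CK.succ K D) Δ.1 Δ.2 ∧
      Δ.1 + Δ.2 = CK.redComul K D ∧
      ∀ d : D, Δ.1 (CK.dot K d) = 0 ∧ Δ.2 (CK.dot K d) = 0) ∧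
    ∀ dL dR : CK.augIdeal K D →ₗ[K] CK.augIdeal K D ⊗[K] CK.augIdeal K D,
      IsBidendriformBialgebra (CK.prec K D) (CK.succ K D) dL dR →
      (∀ d : D, dL (CK.dot K d) = 0 ∧ dR (CK.dot K d) = 0) →
      CK.InducesHopfStructure K D (CK.prec K D) (CK.succ K D) dL dR := by
  have unique : ∀ dL dR : CK.augIdeal K D →ₗ[K] CK.augIdeal K D ⊗[K] CK.augIdeal K D,
      IsBidendriformBialgebra (CK.prec K D) (CK.succ K D) dL dR →
      (∀ d : D, dL (CK.dot K d) = 0 ∧ dR (CK.dot K d) = 0) →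
      dL = CK.redComulL K ∧ dR = CK.redComulR K := fun dL dR h hdot =>
    CK.comul_unique K h (CK.isBidendriformBialgebra K) fun d =>
      ⟨(hdot d).1.trans (CK.redComulL_dot K d).symm, (hdot d).2.trans (CK.redComulR_dot K d).symm⟩
  refine ⟨⟨(CK.redComulL K, CK.redComulR K), ⟨CK.isBidendriformBialgebra K,
    CK.redComulL_add_redComulR K, fun d => ⟨CK.redComulL_dot K d, CK.redComulR_dot K d⟩⟩,
    fun Δ hΔ => ?_⟩, fun dL dR h hdot => ?_⟩
  · obtain ⟨h1, h2⟩ := unique Δ.1 Δ.2 hΔ.1 hΔ.2.2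
    exact Prod.ext h1 h2
  · obtain ⟨rfl, rfl⟩ := unique dL dR h hdot
    exact CK.inducesHopfStructure K
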